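/- Let $G$ be a plane triangulation with $n\ge 3$ vertices (a finite connected simple plane graph all of whose faces, including the outer one, are triangles) with outer vertices $A_1,A_2,A_3$ in counterclockwise order; all other vertices are called inner. Indices are taken modulo $3$. A realizer of $G$ consists of three edge-disjoint directed trees $T_1,T_2,T_3$, where $T_i$ spans the inner vertices and its root $A_i$ and has its edges directed towards $A_i$, such that the counterclockwise order of the edges around each inner vertex is: the one leaving in $T_1$, those entering in $T_3$, the one leaving in $T_2$, those entering in $T_1$, the one leaving in $T_3$, those entering in $T_2$. For an inner vertex $u$ let $P_i(u)$ be the path from $u$ to $A_i$ in $T_i$, and let $R_i(u)$ be the closed region enclosed by $P_{i+1}(u)$, $P_{i+2}(u)$ and the edge $A_{i+1}A_{i+2}$. A Schnyder drawing of $G$ is a placement of its vertices at points of the plane $x_1+x_2+x_3=1$ in $\mathbb R^3$ which is obtained from some realizer in one of the following two ways (edges are drawn as straight segments). 1. (Counting faces.) $A_i$ is placed at the $i$-th unit vector, and each inner vertex $u$ at the point whose $i$-th coordinate is the total weight of the faces in $R_i(u)$, for some positive weights of the inner faces with sum $1$. (Equal weights $\frac1{2n-5}$ give the classical drawing.) 2.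 (Counting vertices.) Each inner vertex $u$ is placed at the point whose $i$-th coordinate is $\frac{1}{n-1}\bigl(|V(R_i(u))|-|V(P_{i-1}(u))|\bigr)$, where $V(R_i(u))$ is the set of vertices in $R_i(u)$, those on its boundary included; and $A_i$ is placed at the point whose coordinates $i,i+1,i+2$ are $\frac{n-2}{n-1},\frac1{n-1},0$. In both cases the outer face is an equilateral triangle. Given a Schnyder drawing, let $u_i$ be the Euclidean distance from the position of the vertex $u$ to the line through the positions of $A_{i+1}$ and $A_{i+2}$, and write $u<_i v$ if $u_i<v_i$. For a vertex $u$ and $k\in\{1,2,3\}$ let $s^u_{2k-1}$ be the set of vertices $v$, placed in the closed outer triangle, such that $u<_k v$ and $v<_j u$ for both $j\ne k$. Then every Schnyder drawing makes $G$ saturated: for every inner vertex $u$ and every $k\in\{1,2,3\}$, exactly one edge incident with $u$ has its other endpoint $v$ in $s^u_{2k-1}$, and this $v$ is the minimum of the sector: $v<_k w$ for every $w\in s^u_{2k-1}$ with $w\ne v$ (in particular no $w\in s^u_{2k-1}$ satisfies both $w<_k v$ and $v<_j w$ for $j\neq k$). -/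

import Mathlib

open Relation

/-- A rotation system on a simple graph (a combinatorial embedding into an oriented surface):
`rot` sends each dart `u → v` to the next dart leaving `u` in counterclockwise order, so that its
cycles are exactly the sets of darts leaving a common vertex. -/
structure RotationSystem {V : Type*} (G : SimpleGraph V) where
  rot : Equiv.Perm G.Dart
  rot_fst : ∀ d, (rot d).fst = d.fst
  rot_sameCycle : ∀ d e : G.Dart, d.fst = e.fst → rot.SameCycle d e

namespace RotationSystem

variable {V : Type*} {G : SimpleGraph V} (S : RotationSystem G)

/-- The next dart along the boundary of the face on the left of a dart `u → v`: the dart leaving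
`v` that precedes `v → u` in the counterclockwise order at `v`. -/
def faceNext : Equiv.Perm G.Dart :=
  (Function.Involutive.toPerm _ (SimpleGraph.Dart.symm_involutive (G := G))).trans S.rot.symm

/-- The faces of the embedding are the cycles of `faceNext`. -/
def Face : Type _ := Quotient (Equiv.Perm.SameCycle.setoid S.faceNext)

/-- The face on the left of a dart. -/
def leftFace (d : G.Dart) : S.Face := Quotient.mk _ d

end RotationSystem

/-- A plane triangulation: a connected simple graph with a rotation system of genus zero (Euler's
formula) all of whose faces, the outer one included, are triangles, together with the vertices
`A 0, A 1, A 2` of the outer face, in counterclockwise order (as seen with the outer face drawn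
unbounded). The outer face is on the left of the darts `A 1 → A 0 → A 2 → A 1`. -/
structure PlaneTriangulation (V : Type*) where
  graph : SimpleGraph V
  connected : graph.Connected
  emb : RotationSystem graph
  euler : Nat.card V + Nat.card emb.Face = Nat.card graph.edgeSet + 2
  triangular : ∀ d, emb.faceNext (emb.faceNext (emb.faceNext d)) = d
  A : Fin 3 → V
  adj_A : ∀ i, graph.Adj (A i) (A (i + 1))
  outer_A : ∀ i, (emb.faceNext ⟨(A (i + 1), A i), (adj_A i).symm⟩).snd = A (i + 2)

namespace PlaneTriangulation

variable {V : Type*} (T : PlaneTriangulation V)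

/-- The outer face. -/
def outerFace : T.emb.Face := T.emb.leftFace ⟨(T.A 1, T.A 0), (T.adj_A 0).symm⟩

/-- Inner vertices are the vertices other than the three outer ones. -/
def IsInner (u : V) : Prop := ∀ i, u ≠ T.A i

/-- Two faces on the two sides of an edge that does not belong to `C`. -/
def FaceStep (C : Set (Sym2 V)) (f g : T.emb.Face) : Prop :=
  ∃ d : T.graph.Dart, d.edge ∉ C ∧ T.emb.leftFace d = f ∧ T.emb.leftFace d.symm = g

/-- The faces enclosed by the edge set `C`: those that cannot be reached from the outer face
without crossing an edge of `C`. -/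
def enclosed (C : Set (Sym2 V)) : Set T.emb.Face :=
  {f | ¬ ReflTransGen (T.FaceStep C) T.outerFace f}

/-- A realizer (Schnyder wood): three edge-disjoint directed trees, the `i`-th one spanning the
inner vertices and its root `A i`, with edges directed towards the root, so that around each inner
vertex the edges are, in counterclockwise order: leaving in tree `0`, entering in tree `2`, leaving
in tree `1`, entering in tree `0`, leaving in tree `2`, entering in tree `1` (one leaving edge per
tree, any number of entering edges). `tree i u v` says that `u → v` is an edge of the `i`-th
tree. -/
structure Realizer where
  tree : Fin 3 → V → V → Prop
  adj : ∀ {i u v}, tree i u v → T.graph.Adj u v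
  isInner : ∀ {i u v}, tree i u v → T.IsInner u
  existsUnique_out : ∀ i u, T.IsInner u → ∃! v, tree i u v
  rooted : ∀ i u, T.IsInner u → ReflTransGen (tree i) u (T.A i)
  disjoint : ∀ {i j u v}, tree i u v → tree j u v → i = j
  disjoint_symm : ∀ {i j u v}, tree i u v → ¬ tree j v u
  /-- After the edge leaving in tree `i`, and after each edge entering in tree `i + 2`, there comes
  an edge entering in tree `i + 2` or the edge leaving in tree `i + 1`. -/
  ccw : ∀ (i : Fin 3) (d : T.graph.Dart), T.IsInner d.fst →
    tree i d.fst d.snd ∨ tree (i + 2) d.snd d.fst →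
    tree (i + 2) (T.emb.rot d).snd d.fst ∨ tree (i + 1) d.fst (T.emb.rot d).snd

namespace Realizer

variable {T} (R : T.Realizer)

/-- The vertices of the path from `u` to the root in the `i`-th tree. -/
def path (i : Fin 3) (u : V) : Set V := {v | ReflTransGen (R.tree i) u v}

/-- The edges of the path from `u` to the root in the `i`-th tree. -/
def pathEdges (i : Fin 3) (u : V) : Set (Sym2 V) :=
  {e | ∃ a ∈ R.path i u, ∃ b, R.tree i a b ∧ e = s(a, b)}

/-- The faces in the `i`-th region of an inner vertex `u`, the region enclosed by the paths from
`u` to the roots `A (i + 1)` and `A (i + 2)` and the outer edge joining these roots. -/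
def regionFaces (i : Fin 3) (u : V) : Set T.emb.Face :=
  T.enclosed (R.pathEdges (i + 1) u ∪ R.pathEdges (i + 2) u ∪ {s(T.A (i + 1), T.A (i + 2))})

/-- The vertices in the `i`-th region of `u`, those on its boundary included. -/
def regionVertices (i : Fin 3) (u : V) : Set V :=
  {v | ∃ d : T.graph.Dart, d.fst = v ∧ T.emb.leftFace d ∈ R.regionFaces i u}

/-- `p` is the drawing that has the outer vertices at the unit vectors and each inner vertex `u` at
the point whose `i`-th coordinate is the total weight of the faces in the `i`-th region of `u`. -/
def IsFaceDrawing (w : T.emb.Face → ℝ) (p : V → EuclideanSpace ℝ (Fin 3)) : Prop :=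
  (∀ i, p (T.A i) = EuclideanSpace.single i 1) ∧
  ∀ u, T.IsInner u → ∀ i, p u i = ∑ᶠ f ∈ R.regionFaces i u, w f

/-- `p` is the drawing that has each inner vertex `u` at the point with `i`-th coordinate
`(number of vertices in region i, minus number of vertices on path i - 1) / (n - 1)`, and the outer
vertex `A i` at the point whose coordinates `i`, `i + 1`, `i + 2` are `(n - 2, 1, 0) / (n - 1)`. -/
def IsVertexDrawing (p : V → EuclideanSpace ℝ (Fin 3)) : Prop :=
  (∀ i, p (T.A i) i = ((Nat.card V : ℝ) - 2) / ((Nat.card V : ℝ) - 1) ∧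
    p (T.A i) (i + 1) = 1 / ((Nat.card V : ℝ) - 1) ∧ p (T.A i) (i + 2) = 0) ∧
  ∀ u, T.IsInner u → ∀ i, p u i =
    (((R.regionVertices i u).ncard : ℝ) - ((R.path (i + 2) u).ncard : ℝ)) /
      ((Nat.card V : ℝ) - 1)

end Realizer

/-- Schnyder drawings of `T`, in the plane `x + y + z = 1`: for some realizer, the face-counting
drawing, with arbitrary positive weights of total 1 on the inner faces (the weight
`1 / (2 n - 5)` of every inner face gives the classical one), or the vertex-counting drawing. -/
def IsSchnyderDrawing (p : V → EuclideanSpace ℝ (Fin 3)) : Prop :=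
  ∃ R : T.Realizer,
    (∃ w : T.emb.Face → ℝ, (∀ f, f ≠ T.outerFace → 0 < w f) ∧
      ∑ᶠ f ∈ {f | f ≠ T.outerFace}, w f = 1 ∧ R.IsFaceDrawing w p) ∨
    R.IsVertexDrawing p

variable (p : V → EuclideanSpace ℝ (Fin 3))

/-- The `i`-th coordinate of `u`: its distance to the line carrying the side of the outer triangle
opposite to `A i`. -/
noncomputable def coord (i : Fin 3) (u : V) : ℝ :=
  Metric.infDist (p u) (line[ℝ, p (T.A (i + 1)), p (T.A (i + 2))] : Set (EuclideanSpace ℝ (Fin 3)))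

/-- The order relation `u <_i v`. -/
def lt (i : Fin 3) (u v : V) : Prop := T.coord p i u < T.coord p i v

/-- For `k = 0, 1, 2` this is the sector `s_1^u`, `s_3^u`, `s_5^u` respectively: the vertices `v` in
the outer triangle with `u <_k v` and `u >_j v` for both `j ≠ k`. -/
def sector (k : Fin 3) (u : V) : Set V :=
  {v | T.lt p k u v ∧ ∀ j, j ≠ k → T.lt p j v u} ∩
    {v | p v ∈ convexHull ℝ (Set.range fun i => p (T.A i))}

/-- `v` is the minimum of `sector k u`: strictly below all its other elements for `<_k`, and
hence also minimal for the intersection of the orders `<_k` and `>_j`, `j ≠ k`. -/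
def IsSectorMin (k : Fin 3) (u v : V) : Prop :=
  v ∈ T.sector p k u ∧ (∀ x ∈ T.sector p k u, x ≠ v → T.lt p k v x) ∧
    ∀ x ∈ T.sector p k u, ¬ (T.lt p k x v ∧ ∀ j, j ≠ k → T.lt p j v x)

/-- Each of the three sectors `s_1^u`, `s_3^u`, `s_5^u` of each inner vertex `u` contains exactly
one neighbour of `u`, and this neighbour is the minimum of the sector. -/
def IsSaturated : Prop :=
  ∀ u, T.IsInner u → ∀ k, (∃! v, v ∈ T.sector p k u ∧ T.graph.Adj u v) ∧
    ∀ v ∈ T.sector p k u, T.graph.Adj u v → T.IsSectorMin p k u v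

end PlaneTriangulation

/-! Saturation follows once each coordinate respects the nesting of regions: if an inner vertex `u`
lies in the `i`-th region of another inner vertex `w`, then `u <_i w`. An edge `u → v` of tree `k`
puts `v` in the two regions of `u` other than the `k`-th, so `v` is in the sector of index `k`;
comparing with the edges of the other kinds shows that no other neighbour is. If `w` is an inner
vertex of that sector, then `u` lies in no region of `w` except the `k`-th, so a face at `u → v`
lies there too. Hence so does `v`, and `v <_k w` (`isSaturated_of_isBarycentric`).

The regions are defined combinatorially, by faces that cannot be reached from the outer face, so a
substitute for the Jordan curve theorem is needed. Genus zero makes every circulation the coboundary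
of a function on the faces (`exists_potential`, a dimension count). The unit flow along the boundary
of a region is a circulation; its potential, normalised to vanish at the outer face, takes integer
values. The local order of the realizer makes it nonnegative (`IsUnimodal.outerFace_le`), and the
three potentials of a vertex add up to 1 on each inner face. So they take the values 0 and 1 only,
and they are the indicators of the regions (`regionFaces_spec`).

Nesting then gives strict inclusion of face sets (`regionFaces_ssubset`), which settles face
counting. For vertex counting it gives a strict lexicographic increase of the `i`-th and `(i +
1)`-st counts (`ncard_countedVertices_lt`), which is enough because the outer triangle is slightly
rotated. -/

namespace RotationSystem

variable {V : Type*} {G : SimpleGraph V} (S : RotationSystem G)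

/-! ### Rotation systems: circulations and potentials on faces. -/

theorem faceNext_apply (d : G.Dart) : S.faceNext d = S.rot.symm d.symm := rfl

theorem rot_symm_fst (d : G.Dart) : (S.rot.symm d).fst = d.fst := by
  have := S.rot_fst (S.rot.symm d)
  rwa [Equiv.apply_symm_apply, eq_comm] at this

theorem faceNext_fst (d : G.Dart) : (S.faceNext d).fst = d.snd := by
  rw [faceNext_apply, rot_symm_fst]; rfl

theorem leftFace_faceNext (d : G.Dart) : S.leftFace (S.faceNext d) = S.leftFace d :=
  Quotient.sound (Equiv.Perm.SameCycle.refl _ _).apply_left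

/-- Consecutive darts `d`, `rot d` bound a common corner. This turns a rotation about a vertex into
a sequence of edge crossings. -/
theorem leftFace_rot_symm (d : G.Dart) : S.leftFace (S.rot d).symm = S.leftFace d := by
  rw [← S.leftFace_faceNext (S.rot d).symm, faceNext_apply, SimpleGraph.Dart.symm_symm,
    Equiv.symm_apply_apply]

theorem exists_leftFace (f : S.Face) : ∃ d, S.leftFace d = f := Quotient.exists_rep f

theorem finite_dart [Finite V] : Finite G.Dart :=
  Finite.of_injective _ SimpleGraph.Dart.toProd_injective

theorem finite_face [Finite V] : Finite S.Face :=
  have : Finite G.Dart := finite_dart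
  Finite.of_surjective S.leftFace S.exists_leftFace

/-- A property of darts that passes to the next dart around a vertex holds for all of its darts
once it holds for one. -/
theorem rot_induction [Finite V] {P : G.Dart → Prop} {d : G.Dart} (hd : P d)
    (step : ∀ e, e.fst = d.fst → P e → P (S.rot e)) {e : G.Dart} (he : e.fst = d.fst) : P e := by
  have : Finite G.Dart := finite_dart
  obtain ⟨n, rfl⟩ := (S.rot_sameCycle d e he.symm).exists_nat_pow_eq
  have key : ∀ m : ℕ, ((S.rot ^ m) d).fst = d.fst ∧ P ((S.rot ^ m) d) := by
    intro m
    induction m with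
    | zero => exact ⟨rfl, hd⟩
    | succ m ih =>
      rw [pow_succ', Equiv.Perm.mul_apply]
      exact ⟨(S.rot_fst _).trans ih.1, step _ ih.1 ih.2⟩
  exact (key n).2

/-- Like `rot_induction`, in clockwise direction. -/
theorem rot_induction_symm [Finite V] {P : G.Dart → Prop} {d : G.Dart} (hd : P d)
    (step : ∀ e, e.fst = d.fst → P (S.rot e) → P e) {e : G.Dart} (he : e.fst = d.fst) : P e := by
  by_contra h
  exact S.rot_induction (P := fun e => ¬ P e) h
    (fun e' he' h' h'' => h' (step e' (he'.trans he) h'')) he.symm hd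

/-- The dual graph is connected. -/
theorem face_induction [Finite V] (hG : G.Connected) {P : S.Face → Prop} {d₀ : G.Dart}
    (h₀ : P (S.leftFace d₀)) (step : ∀ d, P (S.leftFace d) → P (S.leftFace d.symm)) (f : S.Face) :
    P f := by
  have around : ∀ d e : G.Dart, e.fst = d.fst → P (S.leftFace d) → P (S.leftFace e) := by
    intro d e he hd
    refine S.rot_induction (P := fun e => P (S.leftFace e)) hd (fun e _ h => ?_) he
    have := step (S.rot e).symm
    rw [SimpleGraph.Dart.symm_symm, leftFace_rot_symm] at this
    exact this h
  have all : ∀ v, ReflTransGen G.Adj d₀.fst v → ∀ d : G.Dart, d.fst = v → P (S.leftFace d) := by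
    intro v hv
    induction hv with
    | refl => exact fun d hd => around d₀ d hd h₀
    | @tail a b _ hab ih =>
      intro d hd
      exact around ⟨(b, a), hab.symm⟩ d hd (step ⟨(a, b), hab⟩ (ih _ rfl))
  obtain ⟨d, rfl⟩ := S.exists_leftFace f
  exact all d.fst ((SimpleGraph.reachable_iff_reflTransGen _ _).1 (hG.preconnected _ _)) d rfl

/-- Coboundaries have no divergence, stated weakly against a test function `x`: reindexing by `rot`,
which preserves `fst`, makes the two halves of the sum equal. -/
theorem sum_fst_mul_coboundary [Fintype G.Dart] (x : V → ℝ) (g : S.Face → ℝ) :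
    ∑ d : G.Dart, x d.fst * (g (S.leftFace d) - g (S.leftFace d.symm)) = 0 := by
  simp only [mul_sub, Finset.sum_sub_distrib]
  rw [← Equiv.sum_comp S.rot (fun d => x d.fst * g (S.leftFace d.symm)), sub_eq_zero]
  simp only [S.rot_fst, S.leftFace_rot_symm]

/-- Symmetrising over reversal turns the sum into minus one half of the Dirichlet energy of `x`. -/
theorem eq_of_sum_fst_mul_eq_zero [Fintype G.Dart] {x : V → ℝ}
    (h : ∑ d : G.Dart, x d.fst * (x d.snd - x d.fst) = 0) (d : G.Dart) : x d.snd = x d.fst := by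
  have h' : ∑ d : G.Dart, x d.snd * (x d.fst - x d.snd) = 0 := by
    rw [← h, ← Equiv.sum_comp
      (Function.Involutive.toPerm _ (SimpleGraph.Dart.symm_involutive (G := G)))]
    rfl
  have h2 : ∑ d : G.Dart, (x d.snd - x d.fst) ^ 2 = 0 := by
    rw [← neg_eq_zero, ← Finset.sum_neg_distrib, ← add_zero (0 : ℝ)]
    nth_rewrite 1 [← h]
    rw [← h', ← Finset.sum_add_distrib]
    exact Finset.sum_congr rfl fun d _ => by ring
  have := (Finset.sum_eq_zero_iff_of_nonneg fun d _ => sq_nonneg _).1 h2 d (Finset.mem_univ d)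
  exact sub_eq_zero.1 (pow_eq_zero_iff two_ne_zero |>.1 this)

theorem eq_of_coboundary_eq_zero [Finite V] (hG : G.Connected) {g : S.Face → ℝ}
    (h : ∀ d, g (S.leftFace d) - g (S.leftFace d.symm) = 0) (f f' : S.Face) : g f = g f' := by
  obtain ⟨d, rfl⟩ := S.exists_leftFace f'
  exact S.face_induction hG (P := fun f => g f = g (S.leftFace d)) rfl
    (fun e he => (sub_eq_zero.1 (h e)).symm.trans he) f

/-- In an embedding of genus zero, every circulation is the coboundary of a function on faces. -/
theorem exists_potential [Finite V] [Fintype G.Dart] (hG : G.Connected) (d₀ : G.Dart)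
    (euler : Nat.card V + Nat.card S.Face = Nat.card G.edgeSet + 2) {c : G.Dart → ℝ}
    (anti : ∀ d, c d.symm = -c d) (circ : ∀ x : V → ℝ, ∑ d, x d.fst * c d = 0) :
    ∃ g : S.Face → ℝ, ∀ d, g (S.leftFace d) - g (S.leftFace d.symm) = c d := by
  classical
  have : Fintype V := Fintype.ofFinite V
  have : Finite S.Face := S.finite_face
  have : Fintype S.Face := Fintype.ofFinite _
  have : Fintype G.edgeSet := Fintype.ofFinite _
  have hσ : ∀ e : G.edgeSet, ∃ d : G.Dart, d.edge = e := by
    rintro ⟨⟨a, b⟩, h⟩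
    exact ⟨⟨(a, b), h⟩, rfl⟩
  choose σ hσ using hσ
  -- Gradient of a vertex function plus coboundary of a face function, read on the orientation `σ`
  -- of each edge.
  let Φ : (V → ℝ) × (S.Face → ℝ) →ₗ[ℝ] (G.edgeSet → ℝ) :=
    { toFun := fun q e => (q.1 (σ e).snd - q.1 (σ e).fst) +
        (q.2 (S.leftFace (σ e)) - q.2 (S.leftFace (σ e).symm))
      map_add' := fun q r => by ext e; simp; ring
      map_smul' := fun a q => by ext e; simp; ring }
  have ext_dart : ∀ {c : G.Dart → ℝ}, (∀ d, c d.symm = -c d) → ∀ q, (Φ q = fun e => c (σ e)) →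
      ∀ d : G.Dart,
        (q.1 d.snd - q.1 d.fst) + (q.2 (S.leftFace d) - q.2 (S.leftFace d.symm)) = c d := by
    intro c anti q hq d
    have h1 := congrFun hq ⟨d.edge, d.edge_mem⟩
    change (q.1 (σ _).snd - q.1 (σ _).fst) +
      (q.2 (S.leftFace (σ _)) - q.2 (S.leftFace (σ _).symm)) = c (σ _) at h1
    obtain h | h := (SimpleGraph.dart_edge_eq_iff _ _).1 (hσ ⟨d.edge, d.edge_mem⟩)
    · rwa [h] at h1
    · rw [h, anti, SimpleGraph.Dart.symm_symm] at h1
      change (q.1 d.fst - q.1 d.snd) + _ = _ at h1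
      linarith
  -- Gradients are orthogonal to circulations and to coboundaries, so a gradient that is the
  -- difference of two of these vanishes.
  have split : ∀ {c : G.Dart → ℝ}, (∀ d, c d.symm = -c d) →
      (∀ x : V → ℝ, ∑ d, x d.fst * c d = 0) → ∀ q, (Φ q = fun e => c (σ e)) →
      (∀ d : G.Dart, q.1 d.snd = q.1 d.fst) ∧
        ∀ d, q.2 (S.leftFace d) - q.2 (S.leftFace d.symm) = c d := by
    intro c anti circ q hq
    have h := ext_dart anti q hq
    have h1 : ∀ d : G.Dart, q.1 d.snd = q.1 d.fst := by
      refine eq_of_sum_fst_mul_eq_zero ?_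
      rw [← circ q.1, ← add_zero (∑ d, _), ← S.sum_fst_mul_coboundary q.1 q.2,
        ← Finset.sum_add_distrib]
      exact Finset.sum_congr rfl fun d _ => by rw [← h d]; ring
    exact ⟨h1, fun d => by rw [← h d, h1 d]; ring⟩
  obtain ⟨v₀⟩ := hG.nonempty
  -- An element of the kernel is a pair of constants, determined by one value at a vertex and one at
  -- a face.
  have hker : Module.finrank ℝ (LinearMap.ker Φ) ≤ 2 := by
    have f₀ := S.leftFace d₀
    let ψ : LinearMap.ker Φ →ₗ[ℝ] ℝ × ℝ :=
      (((LinearMap.proj v₀).comp (LinearMap.fst ℝ _ _)).prod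
        ((LinearMap.proj f₀).comp (LinearMap.snd ℝ _ _))).comp (LinearMap.ker Φ).subtype
    have hψ : Function.Injective ψ := by
      rw [← LinearMap.ker_eq_bot, LinearMap.ker_eq_bot']
      rintro ⟨⟨x, g⟩, hq⟩ h0
      have hx0 : x v₀ = 0 := congrArg Prod.fst h0
      have hg0 : g f₀ = 0 := congrArg Prod.snd h0
      obtain ⟨hx, hg⟩ := split (c := 0) (by simp) (by simp) (x, g) hq
      have hx' : ∀ v, x v = 0 := by
        intro v
        have := (SimpleGraph.reachable_iff_reflTransGen _ _).1 (hG.preconnected v₀ v)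
        induction this with
        | refl => exact hx0
        | @tail a b _ hab ih => rw [← ih]; exact hx ⟨(a, b), hab⟩
      have hg' : ∀ f, g f = 0 := fun f =>
        (S.eq_of_coboundary_eq_zero hG (g := g) hg f f₀).trans hg0
      simp only [Submodule.mk_eq_zero, Prod.mk_eq_zero]
      exact ⟨funext hx', funext hg'⟩
    simpa using LinearMap.finrank_le_finrank_of_injective hψ
  -- By Euler's formula the source has dimension `|E| + 2`, and the kernel accounts for at most 2.
  have hsurj : Function.Surjective Φ := by
    rw [← LinearMap.range_eq_top]
    apply Submodule.eq_top_of_finrank_eq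
    have h1 := LinearMap.finrank_range_add_finrank_ker Φ
    have h2 := Submodule.finrank_le (LinearMap.range Φ)
    simp only [Module.finrank_prod, Module.finrank_fintype_fun_eq_card] at h1 h2 ⊢
    simp only [Nat.card_eq_fintype_card] at euler
    omega
  obtain ⟨q, hq⟩ := hsurj fun e => c (σ e)
  exact ⟨q.2, (split anti circ q hq).2⟩

end RotationSystem

/-! ### Indices modulo 3 and the faces of a triangulation. -/

theorem Fin.three_add_one_add_one (i : Fin 3) : i + 1 + 1 = i + 2 := by lia
theorem Fin.three_add_one_add_two (i : Fin 3) : i + 1 + 2 = i := by lia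
theorem Fin.three_add_two_add_one (i : Fin 3) : i + 2 + 1 = i := by lia
theorem Fin.three_add_two_add_two (i : Fin 3) : i + 2 + 2 = i + 1 := by lia
theorem Fin.three_add_one_ne (i : Fin 3) : i + 1 ≠ i := by lia
theorem Fin.three_add_two_ne (i : Fin 3) : i + 2 ≠ i := by lia
theorem Fin.three_add_one_ne_add_two (i : Fin 3) : i + 1 ≠ i + 2 := by lia
theorem Fin.three_cases (i j : Fin 3) : j = i ∨ j = i + 1 ∨ j = i + 2 := by lia

namespace PlaneTriangulation

variable {V : Type*} (T : PlaneTriangulation V)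

theorem A_injective : Function.Injective T.A := by
  intro i j h
  obtain rfl | rfl | rfl := Fin.three_cases i j
  · rfl
  · exact absurd h (T.adj_A i).ne
  · have := T.adj_A (i + 2)
    rw [Fin.three_add_two_add_one] at this
    exact absurd h.symm this.ne

theorem not_isInner_A (i : Fin 3) : ¬ T.IsInner (T.A i) := fun h => h i rfl

theorem exists_eq_A {u : V} (h : ¬ T.IsInner u) : ∃ i, u = T.A i := by
  simpa [IsInner] using h

/-- The darts that have the outer face on their left. -/
def outerDart (i : Fin 3) : T.graph.Dart := ⟨(T.A (i + 1), T.A i), (T.adj_A i).symm⟩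

theorem dart_ext {d e : T.graph.Dart} (h₁ : d.fst = e.fst) (h₂ : d.snd = e.snd) : d = e :=
  SimpleGraph.Dart.ext _ _ (Prod.ext h₁ h₂)

theorem faceNext_outerDart (i : Fin 3) :
    T.emb.faceNext (T.outerDart i) = T.outerDart (i + 2) := by
  refine T.dart_ext ?_ (T.outer_A i)
  rw [T.emb.faceNext_fst]
  change T.A i = T.A (i + 2 + 1)
  rw [Fin.three_add_two_add_one]

theorem leftFace_outerDart (i : Fin 3) : T.emb.leftFace (T.outerDart i) = T.outerFace := by
  have h0 : T.emb.leftFace (T.outerDart 0) = T.outerFace := rfl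
  have h2 : T.emb.leftFace (T.outerDart 2) = T.outerFace := by
    rw [← h0, ← T.emb.leftFace_faceNext (T.outerDart 0), faceNext_outerDart]; rfl
  have h1 : T.emb.leftFace (T.outerDart 1) = T.outerFace := by
    rw [← h2, ← T.emb.leftFace_faceNext (T.outerDart 2), faceNext_outerDart]; rfl
  fin_cases i <;> assumption

theorem leftFace_eq_outerFace {d : T.graph.Dart} :
    T.emb.leftFace d = T.outerFace ↔ ∃ i, d = T.outerDart i := by
  constructor
  · intro h
    have h' : T.emb.faceNext.SameCycle (T.outerDart 0) d := Quotient.exact h.symm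
    obtain ⟨n, rfl⟩ := h'
    have key : ∀ n : ℤ, ∃ i, (T.emb.faceNext ^ n) (T.outerDart 0) = T.outerDart i := by
      intro n
      induction n with
      | zero => exact ⟨0, rfl⟩
      | succ n ih =>
        obtain ⟨i, hi⟩ := ih
        refine ⟨i + 2, ?_⟩
        rw [add_comm, zpow_add, Equiv.Perm.mul_apply, hi, zpow_one, faceNext_outerDart]
      | pred n ih =>
        obtain ⟨i, hi⟩ := ih
        refine ⟨i + 1, ?_⟩
        rw [sub_eq_neg_add, zpow_add, Equiv.Perm.mul_apply, hi, zpow_neg, zpow_one,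
          Equiv.Perm.inv_eq_iff_eq, faceNext_outerDart, Fin.three_add_one_add_two]
    exact key n
  · rintro ⟨i, rfl⟩
    exact T.leftFace_outerDart i

/-- The three corners of a face are distinct, and only two outer vertices differ from `A i`. So
every face has a corner from which tree `i` leads to `A i`. -/
theorem exists_dart_isInner_or (i : Fin 3) (f : T.emb.Face) :
    ∃ d, T.emb.leftFace d = f ∧ (T.IsInner d.fst ∨ d.fst = T.A i) := by
  obtain ⟨d, rfl⟩ := T.emb.exists_leftFace f
  by_contra! h
  have h1 := h d rfl
  have h2 := h (T.emb.faceNext d) (T.emb.leftFace_faceNext d)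
  have h3 := h (T.emb.faceNext (T.emb.faceNext d))
    (by rw [T.emb.leftFace_faceNext, T.emb.leftFace_faceNext])
  have e1 := T.emb.faceNext_fst d
  have e2 := T.emb.faceNext_fst (T.emb.faceNext d)
  have e3 := T.emb.faceNext_fst (T.emb.faceNext (T.emb.faceNext d))
  rw [T.triangular] at e3
  have n1 := d.adj.ne
  have n2 := (T.emb.faceNext d).adj.ne
  have n3 := (T.emb.faceNext (T.emb.faceNext d)).adj.ne
  obtain ⟨j, hj⟩ := T.exists_eq_A h1.1
  obtain ⟨k, hk⟩ := T.exists_eq_A h2.1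
  obtain ⟨l, hl⟩ := T.exists_eq_A h3.1
  rw [← e1, hj, hk, T.A_injective.ne_iff] at n1
  rw [← e2, hk, hl, T.A_injective.ne_iff] at n2
  rw [← e3, hl, hj, T.A_injective.ne_iff] at n3
  have m1 := h1.2
  have m2 := h2.2
  have m3 := h3.2
  rw [hj, T.A_injective.ne_iff] at m1
  rw [hk, T.A_injective.ne_iff] at m2
  rw [hl, T.A_injective.ne_iff] at m3
  lia

/-! ### The local structure of a realizer, and unimodal functions. -/

namespace Realizer

variable {T} (R : T.Realizer)

theorem not_tree_A {i j : Fin 3} {v : V} : ¬ R.tree j (T.A i) v := fun h =>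
  T.not_isInner_A i (R.isInner h)

theorem out_unique {i : Fin 3} {u v w : V} (hv : R.tree i u v) (hw : R.tree i u w) : v = w :=
  (R.existsUnique_out i u (R.isInner hv)).unique hv hw

/-- The only edge leaving `u` in tree `j` starts its path to `A j`, and no tree edge leaves `A i`.
-/
theorem eq_of_tree_A {i j : Fin 3} {u : V} (h : R.tree j u (T.A i)) : j = i := by
  have hu := R.isInner h
  obtain h' | ⟨v, hv, hv'⟩ := (R.rooted j u hu).cases_head
  · exact absurd h' (hu j)
  · obtain rfl := R.out_unique h hv
    obtain h' | ⟨w, hw, _⟩ := hv'.cases_head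
    · exact (T.A_injective h').symm
    · exact absurd hw R.not_tree_A

/-- As outgoing edges are unique, a walk on a directed cycle could never leave it to reach the root.
-/
theorem not_reflTransGen {i : Fin 3} {u v : V} (h : R.tree i u v) :
    ¬ ReflTransGen (R.tree i) v u := by
  intro hvu
  have key : ∀ z, ReflTransGen (R.tree i) u z → ReflTransGen (R.tree i) z u := by
    intro z hz
    induction hz with
    | refl => exact .refl
    | @tail a b _ hab ih =>
      obtain rfl | ⟨c, hc, hc'⟩ := ih.cases_head
      · rwa [R.out_unique hab h]
      · rwa [R.out_unique hab hc]
  obtain h' | ⟨w, hw, _⟩ := (key _ (R.rooted i u (R.isInner h))).cases_head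
  · exact R.isInner h i h'.symm
  · exact R.not_tree_A hw

theorem exists_out_dart (i : Fin 3) {u : V} (hu : T.IsInner u) :
    ∃ d : T.graph.Dart, d.fst = u ∧ R.tree i d.fst d.snd := by
  obtain ⟨v, hv, _⟩ := R.existsUnique_out i u hu
  exact ⟨⟨(u, v), R.adj hv⟩, rfl, hv⟩

theorem out_dart_unique {i : Fin 3} {d e : T.graph.Dart} (h : d.fst = e.fst)
    (hd : R.tree i d.fst d.snd) (he : R.tree i e.fst e.snd) : d = e :=
  T.dart_ext h (R.out_unique hd (h ▸ he))

/-- The darts around an inner vertex fall into three intervals: the `i`-th one consists of the dart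
leaving in tree `i` and the following darts entering in tree `i + 2`. -/
def InInterval (i : Fin 3) (d : T.graph.Dart) : Prop :=
  R.tree i d.fst d.snd ∨ R.tree (i + 2) d.snd d.fst

variable {R}

theorem InInterval.unique {i j : Fin 3} {d : T.graph.Dart} (hi : R.InInterval i d)
    (hj : R.InInterval j d) : i = j := by
  obtain hi | hi := hi <;> obtain hj | hj := hj
  · exact R.disjoint hi hj
  · exact absurd hj (R.disjoint_symm hi)
  · exact absurd hj (R.disjoint_symm hi)
  · exact add_right_cancel (R.disjoint hi hj)

theorem InInterval.rot {i : Fin 3} {d : T.graph.Dart} (h : R.InInterval i d)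
    (hd : T.IsInner d.fst) :
    R.tree (i + 2) (T.emb.rot d).snd (T.emb.rot d).fst ∨
      R.tree (i + 1) (T.emb.rot d).fst (T.emb.rot d).snd := by
  rw [T.emb.rot_fst]
  exact R.ccw i d hd h

variable (R)

theorem exists_inInterval [Finite V] {d : T.graph.Dart} (hd : T.IsInner d.fst) :
    ∃ i, R.InInterval i d := by
  obtain ⟨e, he, he'⟩ := R.exists_out_dart 0 hd
  refine T.emb.rot_induction (P := fun d => ∃ i, R.InInterval i d) (d := e) ⟨0, .inl he'⟩ ?_ he.symm
  rintro f hf ⟨i, hi⟩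
  obtain h | h := hi.rot (by rwa [hf, he])
  · exact ⟨i, .inr h⟩
  · exact ⟨i + 1, .inl h⟩

variable {R}

theorem inInterval_of_rot [Finite V] {j : Fin 3} {d : T.graph.Dart} (hd : T.IsInner d.fst)
    (h : R.tree (j + 2) (T.emb.rot d).snd (T.emb.rot d).fst) : R.InInterval j d := by
  obtain ⟨i, hi⟩ := R.exists_inInterval hd
  obtain h' | h' := hi.rot hd
  · rwa [add_right_cancel (R.disjoint h h')]
  · exact absurd h (R.disjoint_symm h')

variable {g : T.emb.Face → ℝ}

/-- A function on the faces that increases across the edges entering in tree `j + 2` increases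
on the interval between the edges leaving in the trees `j` and `j + 1`. -/
theorem le_of_inInterval [Finite V] {j : Fin 3} {d d₀ d₁ : T.graph.Dart}
    (hd : T.IsInner d.fst) (hdj : R.InInterval j d)
    (h : ∀ e : T.graph.Dart, e.fst = d.fst → R.tree (j + 2) e.snd e.fst →
      g (T.emb.leftFace e.symm) ≤ g (T.emb.leftFace e))
    (h₀ : d₀.fst = d.fst) (h₀' : R.tree j d₀.fst d₀.snd)
    (h₁ : d₁.fst = d.fst) (h₁' : R.tree (j + 1) d₁.fst d₁.snd) :
    g (T.emb.leftFace d₀) ≤ g (T.emb.leftFace d) ∧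
      g (T.emb.leftFace d) ≤ g (T.emb.leftFace d₁.symm) := by
  constructor
  · refine T.emb.rot_induction (d := d₀)
      (P := fun e => R.InInterval j e → g (T.emb.leftFace d₀) ≤ g (T.emb.leftFace e))
      (fun _ => le_rfl) ?_ h₀.symm hdj
    intro e he ih he'
    obtain he' | he' := he'
    · rw [R.out_dart_unique ((T.emb.rot_fst e).trans he).symm h₀' he']
    · have h2 := h _ ((T.emb.rot_fst e).trans (he.trans h₀)) he'
      rw [T.emb.leftFace_rot_symm] at h2
      exact (ih (inInterval_of_rot (by rwa [he, h₀]) he')).trans h2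
  · refine T.emb.rot_induction_symm (d := d₁)
      (P := fun e => R.InInterval j e → g (T.emb.leftFace e) ≤ g (T.emb.leftFace d₁.symm))
      -- The start `d₁` belongs to the next interval, so the base case is vacuous.
      (fun h' => absurd (h'.unique (.inl h₁')) (Fin.three_add_one_ne j).symm) ?_ h₁.symm hdj
    intro e he ih he'
    obtain h' | h' := he'.rot (by rwa [he, h₁])
    · have h2 := h _ ((T.emb.rot_fst e).trans (he.trans h₁)) h'
      rw [T.emb.leftFace_rot_symm] at h2
      exact h2.trans (ih (.inr h'))
    · rw [R.out_dart_unique ((T.emb.rot_fst e).trans he).symm h₁' h', T.emb.leftFace_rot_symm]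

theorem ge_of_inInterval [Finite V] {j : Fin 3} {d d₀ d₁ : T.graph.Dart}
    (hd : T.IsInner d.fst) (hdj : R.InInterval j d)
    (h : ∀ e : T.graph.Dart, e.fst = d.fst → R.tree (j + 2) e.snd e.fst →
      g (T.emb.leftFace e) ≤ g (T.emb.leftFace e.symm))
    (h₀ : d₀.fst = d.fst) (h₀' : R.tree j d₀.fst d₀.snd)
    (h₁ : d₁.fst = d.fst) (h₁' : R.tree (j + 1) d₁.fst d₁.snd) :
    g (T.emb.leftFace d₁.symm) ≤ g (T.emb.leftFace d) ∧
      g (T.emb.leftFace d) ≤ g (T.emb.leftFace d₀) := by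
  have := le_of_inInterval (g := fun f => - g f) hd hdj (fun e he he' => neg_le_neg (h e he he'))
    h₀ h₀' h₁ h₁'
  exact ⟨neg_le_neg_iff.1 this.2, neg_le_neg_iff.1 this.1⟩

variable (R)

/-- A function on the faces is unimodal if, from right to left, it does not change across the edges
of tree `i`, increases across those of tree `i + 1` and decreases across those of tree `i + 2`, and
is constant around `A i`. Around each inner vertex it then has its minimum at the edge leaving in
tree `i`, and its maximum between the other two leaving edges. -/
structure IsUnimodal (i : Fin 3) (g : T.emb.Face → ℝ) : Prop where
  eq : ∀ d : T.graph.Dart, R.tree i d.fst d.snd →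
    g (T.emb.leftFace d) = g (T.emb.leftFace d.symm)
  ge : ∀ d : T.graph.Dart, R.tree (i + 1) d.fst d.snd →
    g (T.emb.leftFace d.symm) ≤ g (T.emb.leftFace d)
  le : ∀ d : T.graph.Dart, R.tree (i + 2) d.fst d.snd →
    g (T.emb.leftFace d) ≤ g (T.emb.leftFace d.symm)
  eq_A : ∀ d : T.graph.Dart, d.fst = T.A i →
    g (T.emb.leftFace d) = g (T.emb.leftFace d.symm)

namespace IsUnimodal

variable {R} {i : Fin 3} {d d₀ d₁ d₂ : T.graph.Dart}

/-- Counterclockwise, `g` rises in interval `i`, is constant in interval `i + 1` and falls in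
interval `i + 2`. -/
theorem around [Finite V] (hg : R.IsUnimodal i g)
    (h₀ : d₀.fst = d.fst) (h₀' : R.tree i d₀.fst d₀.snd)
    (h₁ : d₁.fst = d.fst) (h₁' : R.tree (i + 1) d₁.fst d₁.snd)
    (h₂ : d₂.fst = d.fst) (h₂' : R.tree (i + 2) d₂.fst d₂.snd) :
    g (T.emb.leftFace d₀) ≤ g (T.emb.leftFace d) ∧
      g (T.emb.leftFace d) ≤ g (T.emb.leftFace d₁) ∧
      g (T.emb.leftFace d₁) = g (T.emb.leftFace d₂.symm) := by
  have hd : T.IsInner d.fst := h₀ ▸ R.isInner h₀'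
  have s0 : ∀ e : T.graph.Dart, e.fst = d.fst → R.tree (i + 2) e.snd e.fst →
      g (T.emb.leftFace e.symm) ≤ g (T.emb.leftFace e) := fun e _ he => hg.le e.symm he
  have s1 : ∀ e : T.graph.Dart, e.fst = d.fst → R.tree (i + 1 + 2) e.snd e.fst →
      g (T.emb.leftFace e.symm) = g (T.emb.leftFace e) := fun e _ he =>
    hg.eq e.symm (by rwa [Fin.three_add_one_add_two] at he)
  have s2 : ∀ e : T.graph.Dart, e.fst = d.fst → R.tree (i + 2 + 2) e.snd e.fst →
      g (T.emb.leftFace e) ≤ g (T.emb.leftFace e.symm) := fun e _ he =>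
    hg.ge e.symm (by rwa [Fin.three_add_two_add_two] at he)
  have h₂1 : R.tree (i + 1 + 1) d₂.fst d₂.snd := by rwa [Fin.three_add_one_add_one]
  have h₀1 : R.tree (i + 2 + 1) d₀.fst d₀.snd := by rwa [Fin.three_add_two_add_one]
  have e0 := hg.eq d₀ h₀'
  have e1 := hg.ge d₁ h₁'
  have e2 := hg.le d₂ h₂'
  have t0 := le_of_inInterval (d := d₀) (by rwa [h₀]) (.inl h₀') (h₀ ▸ s0) rfl h₀'
    (h₁.trans h₀.symm) h₁'
  have t1 := le_of_inInterval (d := d₁) (by rwa [h₁]) (.inl h₁') (h₁ ▸ fun e he he' =>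
    (s1 e he he').le) rfl h₁' (h₂.trans h₁.symm) h₂1
  have t1' := ge_of_inInterval (d := d₁) (by rwa [h₁]) (.inl h₁') (h₁ ▸ fun e he he' =>
    (s1 e he he').ge) rfl h₁' (h₂.trans h₁.symm) h₂1
  have t2 := ge_of_inInterval (d := d₂) (by rwa [h₂]) (.inl h₂') (h₂ ▸ s2) rfl h₂'
    (h₀.trans h₂.symm) h₀1
  obtain ⟨j, hj⟩ := R.exists_inInterval hd
  obtain rfl | rfl | rfl := Fin.three_cases i j
  · have := le_of_inInterval hd hj s0 h₀ h₀' h₁ h₁'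
    exact ⟨by linarith, by linarith, by linarith⟩
  · have := le_of_inInterval hd hj (fun e he he' => (s1 e he he').le) h₁ h₁' h₂ h₂1
    have := ge_of_inInterval hd hj (fun e he he' => (s1 e he he').ge) h₁ h₁' h₂ h₂1
    exact ⟨by linarith, by linarith, by linarith⟩
  · have := ge_of_inInterval hd hj s2 h₂ h₂' h₀ h₀1
    exact ⟨by linarith, by linarith, by linarith⟩

theorem around_A [Finite V] (hg : R.IsUnimodal i g) (hd : d.fst = T.A i) :
    g (T.emb.leftFace d) = g T.outerFace := by
  have h : (T.outerDart (i + 2)).fst = T.A i := by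
    change T.A (i + 2 + 1) = _
    rw [Fin.three_add_two_add_one]
  refine T.emb.rot_induction (d := T.outerDart (i + 2))
    (P := fun d => g (T.emb.leftFace d) = g T.outerFace) (by rw [T.leftFace_outerDart]) ?_
    (hd.trans h.symm)
  intro e he ih
  rw [hg.eq_A _ ((T.emb.rot_fst e).trans (he.trans h)), T.emb.leftFace_rot_symm, ih]

/-- A unimodal function has its minimum at the outer face. -/
theorem outerFace_le [Finite V] (hg : R.IsUnimodal i g) (f : T.emb.Face) :
    g T.outerFace ≤ g f := by
  obtain ⟨d, rfl, hd⟩ := T.exists_dart_isInner_or i f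
  have hr : ReflTransGen (R.tree i) d.fst (T.A i) := by
    obtain hd | hd := hd
    · exact R.rooted i _ hd
    · rw [hd]
  have key : ∀ y, ReflTransGen (R.tree i) y (T.A i) → ∀ d : T.graph.Dart, d.fst = y →
      g T.outerFace ≤ g (T.emb.leftFace d) := by
    intro y hy
    induction hy using ReflTransGen.head_induction_on with
    | refl => exact fun d hd => (hg.around_A hd).ge
    | @head a b hab _ ih =>
      intro d hd
      have ha : T.IsInner d.fst := hd ▸ R.isInner hab
      obtain ⟨d₁, h₁, h₁'⟩ := R.exists_out_dart (i + 1) ha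
      obtain ⟨d₂, h₂, h₂'⟩ := R.exists_out_dart (i + 2) ha
      -- Descend along tree `i`: the least value at `a` is taken beside the edge `a → b`, where `g`
      -- has the same value on both sides, so it is also a value at `b`.
      refine le_trans ?_ (hg.around (d₀ := ⟨(a, b), R.adj hab⟩) hd.symm hab h₁ h₁' h₂ h₂').1
      rw [hg.eq _ hab]
      exact ih _ rfl
  exact key _ hr d rfl

end IsUnimodal

end Realizer

end PlaneTriangulation

/-! ### Boundary flows and their potentials: the regions. -/

namespace PlaneTriangulation

variable {V : Type*} {T : PlaneTriangulation V}

/-- The unit flow along a set of darts. -/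
noncomputable def flow (D : Set T.graph.Dart) (d : T.graph.Dart) : ℝ :=
  D.indicator 1 d - D.indicator 1 d.symm

theorem flow_symm (D : Set T.graph.Dart) (d : T.graph.Dart) : flow D d.symm = -flow D d := by
  simp [flow]

theorem exists_int_flow (D : Set T.graph.Dart) (d : T.graph.Dart) : ∃ n : ℤ, flow D d = n := by
  classical
  refine ⟨D.indicator 1 d - D.indicator 1 d.symm, ?_⟩
  simp only [flow, Set.indicator_apply]
  push_cast
  simp

theorem flow_of_mem {D : Set T.graph.Dart} {d : T.graph.Dart} (h : d ∈ D) (h' : d.symm ∉ D) :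
    flow D d = 1 := by
  simp [flow, h, h']

theorem flow_of_notMem {D : Set T.graph.Dart} {d : T.graph.Dart} (h : d ∉ D) (h' : d.symm ∉ D) :
    flow D d = 0 := by
  simp [flow, h, h']

theorem sum_flow_singleton [Fintype T.graph.Dart] (x : V → ℝ) (e : T.graph.Dart) :
    ∑ d, x d.fst * flow {e} d = x e.fst - x e.snd := by
  classical
  have h : ∀ d : T.graph.Dart, d.symm = e ↔ d = e.symm := fun d =>
    SimpleGraph.Dart.symm_involutive.eq_iff
  simp [flow, Set.indicator_apply, mul_sub, Finset.sum_sub_distrib, h]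

theorem flow_insert {D : Set T.graph.Dart} {e : T.graph.Dart} (h : e ∉ D) (d : T.graph.Dart) :
    flow (insert e D) d = flow {e} d + flow D d := by
  have key : ∀ d, (insert e D).indicator (1 : T.graph.Dart → ℝ) d =
      Set.indicator {e} 1 d + D.indicator 1 d := by
    intro d
    by_cases hd : d = e
    · subst hd; simp [h]
    · by_cases hd' : d ∈ D <;> simp [hd, hd']
  simp only [flow, key]
  ring

namespace Realizer

variable (R : T.Realizer)

/-- The darts of the path from `u` to the root in the `i`-th tree. -/
def pathDarts (i : Fin 3) (u : V) : Set T.graph.Dart :=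
  {d | R.tree i d.fst d.snd ∧ d.fst ∈ R.path i u}

theorem pathDarts_A (i : Fin 3) : R.pathDarts i (T.A i) = ∅ := by
  ext d
  simp only [pathDarts, path, Set.mem_ofPred_eq, Set.mem_empty_iff_false, iff_false, not_and]
  intro h h'
  obtain h' | ⟨v, hv, _⟩ := h'.cases_head
  · exact R.not_tree_A (h' ▸ h)
  · exact R.not_tree_A hv

variable {R}

theorem mem_path_iff {i : Fin 3} {u v w : V} (h : R.tree i u v) :
    w ∈ R.path i u ↔ w = u ∨ w ∈ R.path i v := by
  refine ReflTransGen.cases_head_iff.trans (or_congr eq_comm ⟨?_, fun h' => ⟨v, h, h'⟩⟩)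
  rintro ⟨x, hx, hx'⟩
  rwa [R.out_unique h hx]

theorem pathDarts_eq_insert {i : Fin 3} {u v : V} (h : R.tree i u v) :
    R.pathDarts i u = insert ⟨(u, v), R.adj h⟩ (R.pathDarts i v) := by
  ext d
  simp only [pathDarts, Set.mem_ofPred_eq, Set.mem_insert_iff, mem_path_iff h, and_or_left]
  refine or_congr ⟨fun h' => ?_, fun h' => ?_⟩ Iff.rfl
  · exact T.dart_ext h'.2 (R.out_unique h'.1 (h'.2 ▸ h))
  · subst h'; exact ⟨h, rfl⟩

variable (R)

theorem sum_flow_pathDarts [Fintype T.graph.Dart] (x : V → ℝ) {i : Fin 3} {u : V}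
    (hu : T.IsInner u) : ∑ d, x d.fst * flow (R.pathDarts i u) d = x u - x (T.A i) := by
  have h := R.rooted i u hu
  induction h using ReflTransGen.head_induction_on with
  | refl => exact absurd hu (T.not_isInner_A i)
  | @head a b hab hb ih =>
    have hmem : (⟨(a, b), R.adj hab⟩ : T.graph.Dart) ∉ R.pathDarts i b := fun h' =>
      R.not_reflTransGen hab h'.2
    simp only [pathDarts_eq_insert hab, flow_insert hmem, mul_add, Finset.sum_add_distrib,
      sum_flow_singleton]
    have : ∑ d, x d.fst * flow (R.pathDarts i b) d = x b - x (T.A i) := by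
      -- The induction hypothesis requires an inner vertex; at the root the path has no darts.
      by_cases hb' : T.IsInner b
      · exact ih hb'
      · obtain ⟨j, rfl⟩ := T.exists_eq_A hb'
        obtain rfl := R.eq_of_tree_A hab
        simp [pathDarts_A, flow]
    rw [this]
    ring

/-- The unit flow along the boundary of the `i`-th region of `u`. -/
noncomputable def boundaryFlow (i : Fin 3) (u : V) (d : T.graph.Dart) : ℝ :=
  flow (R.pathDarts (i + 1) u) d - flow (R.pathDarts (i + 2) u) d - flow {T.outerDart (i + 1)} d

theorem boundaryFlow_symm (i : Fin 3) (u : V) (d : T.graph.Dart) :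
    R.boundaryFlow i u d.symm = -R.boundaryFlow i u d := by
  simp only [boundaryFlow, flow_symm]
  ring

theorem sum_boundaryFlow [Fintype T.graph.Dart] (x : V → ℝ) {i : Fin 3} {u : V}
    (hu : T.IsInner u) : ∑ d, x d.fst * R.boundaryFlow i u d = 0 := by
  simp only [boundaryFlow, mul_sub, Finset.sum_sub_distrib, R.sum_flow_pathDarts x hu,
    sum_flow_singleton]
  change x u - x (T.A (i + 1)) - (x u - x (T.A (i + 2))) - (x (T.A (i + 1 + 1)) - _) = 0
  rw [Fin.three_add_one_add_one]
  change _ - (_ - x (T.A (i + 1))) = 0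
  ring

theorem exists_int_boundaryFlow (i : Fin 3) (u : V) (d : T.graph.Dart) :
    ∃ n : ℤ, R.boundaryFlow i u d = n := by
  obtain ⟨a, ha⟩ := exists_int_flow (R.pathDarts (i + 1) u) d
  obtain ⟨b, hb⟩ := exists_int_flow (R.pathDarts (i + 2) u) d
  obtain ⟨c, hc⟩ := exists_int_flow {T.outerDart (i + 1)} d
  exact ⟨a - b - c, by simp [boundaryFlow, ha, hb, hc]⟩

variable {R}

theorem flow_pathDarts_of_ne {i j : Fin 3} {u : V} {d : T.graph.Dart}
    (h : R.tree j d.fst d.snd) (hij : i ≠ j) : flow (R.pathDarts i u) d = 0 :=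
  flow_of_notMem (fun h' => hij (R.disjoint h'.1 h)) fun h' => R.disjoint_symm h h'.1

theorem flow_pathDarts_of_mem {i : Fin 3} {u : V} {d : T.graph.Dart}
    (h : d ∈ R.pathDarts i u) : flow (R.pathDarts i u) d = 1 :=
  flow_of_mem h fun h' => R.disjoint_symm h.1 h'.1

theorem flow_pathDarts_of_notMem {i : Fin 3} {u : V} {d : T.graph.Dart}
    (h : R.tree i d.fst d.snd) (hd : d.fst ∉ R.path i u) : flow (R.pathDarts i u) d = 0 :=
  flow_of_notMem (fun h' => hd h'.2) fun h' => R.disjoint_symm h h'.1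

theorem ne_outerDart {i j : Fin 3} {d : T.graph.Dart} (h : R.tree i d.fst d.snd) :
    d ≠ T.outerDart j ∧ d.symm ≠ T.outerDart j := by
  refine ⟨?_, fun h' => ?_⟩
  · rintro rfl
    exact R.not_tree_A h
  · obtain rfl := (SimpleGraph.Dart.symm_involutive.eq_iff).1 h'
    exact R.not_tree_A h

theorem flow_outerDart {i j : Fin 3} {d : T.graph.Dart} (h : R.tree i d.fst d.snd) :
    flow {T.outerDart j} d = 0 :=
  flow_of_notMem (ne_outerDart h).1 (ne_outerDart h).2

theorem boundaryFlow_of_tree {i : Fin 3} {u : V} {d : T.graph.Dart} (h : R.tree i d.fst d.snd) :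
    R.boundaryFlow i u d = 0 := by
  rw [boundaryFlow, flow_pathDarts_of_ne h (Fin.three_add_one_ne i),
    flow_pathDarts_of_ne h (Fin.three_add_two_ne i), flow_outerDart h]
  ring

theorem boundaryFlow_of_tree_add_one {i : Fin 3} {u : V} {d : T.graph.Dart}
    (h : R.tree (i + 1) d.fst d.snd) :
    R.boundaryFlow i u d = flow (R.pathDarts (i + 1) u) d := by
  rw [boundaryFlow, flow_pathDarts_of_ne h (Fin.three_add_one_ne_add_two i).symm, flow_outerDart h]
  ring

theorem boundaryFlow_of_tree_add_two {i : Fin 3} {u : V} {d : T.graph.Dart}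
    (h : R.tree (i + 2) d.fst d.snd) :
    R.boundaryFlow i u d = -flow (R.pathDarts (i + 2) u) d := by
  rw [boundaryFlow, flow_pathDarts_of_ne h (Fin.three_add_one_ne_add_two i), flow_outerDart h]
  ring

theorem boundaryFlow_of_fst_eq_A {i : Fin 3} {u : V} {d : T.graph.Dart} (h : d.fst = T.A i) :
    R.boundaryFlow i u d = 0 := by
  have key : ∀ j, j ≠ i → flow (R.pathDarts j u) d = 0 := fun j hj => by
    refine flow_of_notMem (fun h' => R.not_tree_A (h ▸ h'.1)) fun h' => hj ?_
    have h'' : R.tree j d.snd d.fst := h'.1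
    rw [h] at h''
    exact (R.eq_of_tree_A h'')
  rw [boundaryFlow, key _ (Fin.three_add_one_ne i), key _ (Fin.three_add_two_ne i),
    flow_of_notMem, sub_zero, sub_zero]
  · rintro rfl
    exact (by lia : i + 1 + 1 ≠ i) (T.A_injective h)
  · intro h'
    obtain rfl := (SimpleGraph.Dart.symm_involutive.eq_iff).1 h'
    exact (Fin.three_add_one_ne i) (T.A_injective h)

variable (R) in
/-- The edges that bound the `i`-th region of `u`. -/
def boundaryEdges (i : Fin 3) (u : V) : Set (Sym2 V) :=
  R.pathEdges (i + 1) u ∪ R.pathEdges (i + 2) u ∪ {s(T.A (i + 1), T.A (i + 2))}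

theorem edge_mem_pathEdges {i : Fin 3} {u : V} {d : T.graph.Dart} :
    d.edge ∈ R.pathEdges i u ↔ d ∈ R.pathDarts i u ∨ d.symm ∈ R.pathDarts i u := by
  constructor
  · rintro ⟨a, ha, b, hab, h⟩
    obtain rfl | rfl := (SimpleGraph.dart_edge_eq_iff d ⟨(a, b), R.adj hab⟩).1 h
    · exact .inl ⟨hab, ha⟩
    · exact .inr ⟨hab, ha⟩
  · rintro (h | h)
    · exact ⟨_, h.2, _, h.1, rfl⟩
    · exact ⟨_, h.2, _, h.1, Sym2.eq_swap⟩

theorem edge_mem_outer {i : Fin 3} {d : T.graph.Dart} :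
    d.edge = s(T.A (i + 1), T.A (i + 2)) ↔ d = T.outerDart (i + 1) ∨
      d.symm = T.outerDart (i + 1) := by
  have : (T.outerDart (i + 1)).edge = s(T.A (i + 1), T.A (i + 2)) := by
    change s(T.A (i + 1 + 1), T.A (i + 1)) = _
    rw [Fin.three_add_one_add_one, Sym2.eq_swap]
  rw [← this, SimpleGraph.dart_edge_eq_iff, SimpleGraph.Dart.symm_involutive.eq_iff]

/-- Nothing cancels: the trees are edge-disjoint and never use an outer edge, since their edges
leave inner vertices. -/
theorem boundaryFlow_eq_zero_iff {i : Fin 3} {u : V} {d : T.graph.Dart} :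
    R.boundaryFlow i u d = 0 ↔ d.edge ∉ R.boundaryEdges i u := by
  rw [← not_iff_not, not_not]
  constructor
  · contrapose!
    simp only [boundaryEdges, Set.mem_union, Set.mem_singleton_iff, edge_mem_pathEdges,
      edge_mem_outer, not_or]
    rintro ⟨⟨⟨h1, h2⟩, h3, h4⟩, h5, h6⟩
    rw [boundaryFlow, flow_of_notMem h1 h2, flow_of_notMem h3 h4,
      flow_of_notMem (D := {T.outerDart (i + 1)}) h5 h6]
    ring
  · simp only [boundaryEdges, Set.mem_union, Set.mem_singleton_iff, edge_mem_pathEdges,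
      edge_mem_outer]
    suffices h : ∀ d : T.graph.Dart, d ∈ R.pathDarts (i + 1) u ∨ d ∈ R.pathDarts (i + 2) u ∨
        d = T.outerDart (i + 1) → R.boundaryFlow i u d ≠ 0 by
      have h' : R.boundaryFlow i u d.symm ≠ 0 → R.boundaryFlow i u d ≠ 0 := by
        rw [boundaryFlow_symm, neg_ne_zero]; exact id
      rintro (((h1 | h1) | (h1 | h1)) | (h1 | h1))
      · exact h _ (.inl h1)
      · exact h' (h _ (.inl h1))
      · exact h _ (.inr (.inl h1))
      · exact h' (h _ (.inr (.inl h1)))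
      · exact h _ (.inr (.inr h1))
      · exact h' (h _ (.inr (.inr h1)))
    rintro d (h | h | rfl)
    · rw [boundaryFlow_of_tree_add_one h.1, flow_pathDarts_of_mem h]; norm_num
    · rw [boundaryFlow_of_tree_add_two h.1, flow_pathDarts_of_mem h]; norm_num
    · have h1 : ∀ j, flow (R.pathDarts j u) (T.outerDart (i + 1)) = 0 := fun j =>
        flow_of_notMem (fun h => R.not_tree_A h.1) fun h => R.not_tree_A h.1
      rw [boundaryFlow, h1, h1, flow_of_mem (Set.mem_singleton _)]
      · norm_num
      · intro h
        have := congrArg (fun d : T.graph.Dart => d.fst) h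
        exact (by lia : i + 1 ≠ i + 1 + 1) (T.A_injective this)

/-- Each of the three paths bounds two regions, with opposite signs, so only the outer edges remain.
-/
theorem sum_boundaryFlow_eq {u : V} (d : T.graph.Dart) :
    ∑ i, R.boundaryFlow i u d = -∑ i, flow {T.outerDart i} d := by
  simp only [Fin.sum_univ_three, boundaryFlow]
  change flow (R.pathDarts 1 u) d - flow (R.pathDarts 2 u) d - flow {T.outerDart 1} d +
    (flow (R.pathDarts 2 u) d - flow (R.pathDarts 0 u) d - flow {T.outerDart 2} d) +
    (flow (R.pathDarts 0 u) d - flow (R.pathDarts 1 u) d - flow {T.outerDart 0} d) = _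
  ring

open Classical in
theorem sum_flow_outerDart (d : T.graph.Dart) : ∑ i, flow {T.outerDart i} d =
    (if T.emb.leftFace d = T.outerFace then (1 : ℝ) else 0) -
      if T.emb.leftFace d.symm = T.outerFace then 1 else 0 := by
  have key : ∀ d, (if T.emb.leftFace d = T.outerFace then (1 : ℝ) else 0) =
      ∑ i, Set.indicator {T.outerDart i} 1 d := by
    intro d
    split_ifs with h
    · obtain ⟨i, rfl⟩ := T.leftFace_eq_outerFace.1 h
      rw [Finset.sum_eq_single i]
      · simp
      · intro j _ hj
        rw [Set.indicator_of_notMem]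
        intro h
        exact hj (T.A_injective (congrArg (fun d : T.graph.Dart => d.snd) h)).symm
      · simp
    · rw [Finset.sum_eq_zero]
      intro i _
      rw [Set.indicator_of_notMem]
      intro h'
      exact h (T.leftFace_eq_outerFace.2 ⟨i, h'⟩)
  rw [key, key, ← Finset.sum_sub_distrib]
  rfl

theorem IsUnimodal.of_le {i : Fin 3} {g g' : T.emb.Face → ℝ} (hg : R.IsUnimodal i g)
    (h : ∀ d, g (T.emb.leftFace d.symm) ≤ g (T.emb.leftFace d) →
      g' (T.emb.leftFace d.symm) ≤ g' (T.emb.leftFace d)) : R.IsUnimodal i g' where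
  eq d hd := le_antisymm (h d.symm (hg.eq d hd).le) (h d (hg.eq d hd).ge)
  ge d hd := h d (hg.ge d hd)
  le d hd := h d.symm (hg.le d hd)
  eq_A d hd := le_antisymm (h d.symm (hg.eq_A d hd).le) (h d (hg.eq_A d hd).ge)

theorem isUnimodal_of_boundaryFlow {i : Fin 3} {u : V} {g : T.emb.Face → ℝ}
    (h : ∀ d, g (T.emb.leftFace d) - g (T.emb.leftFace d.symm) = R.boundaryFlow i u d) :
    R.IsUnimodal i g := by
  have nonneg : ∀ (j : Fin 3) (d : T.graph.Dart), R.tree j d.fst d.snd →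
      0 ≤ flow (R.pathDarts j u) d := by
    intro j d hd
    by_cases h : d.fst ∈ R.path j u
    · rw [flow_pathDarts_of_mem ⟨hd, h⟩]; exact zero_le_one
    · rw [flow_pathDarts_of_notMem hd h]
  refine ⟨fun d hd => ?_, fun d hd => ?_, fun d hd => ?_, fun d hd => ?_⟩
  · rw [← sub_eq_zero, h, boundaryFlow_of_tree hd]
  · rw [← sub_nonneg, h, boundaryFlow_of_tree_add_one hd]
    exact nonneg _ d hd
  · rw [← sub_nonpos, h, boundaryFlow_of_tree_add_two hd, neg_nonpos]
    exact nonneg _ d hd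
  · rw [← sub_eq_zero, h, boundaryFlow_of_fst_eq_A hd]

open Classical in
theorem indicator_regionFaces [Finite V] {i : Fin 3} {u : V} {g : T.emb.Face → ℝ}
    (h : ∀ d, g (T.emb.leftFace d) - g (T.emb.leftFace d.symm) = R.boundaryFlow i u d)
    (h₀ : g T.outerFace = 0) (h01 : ∀ f, g f = 0 ∨ g f = 1) (f : T.emb.Face) :
    g f = (R.regionFaces i u).indicator 1 f := by
  have step : ∀ f f', T.FaceStep (R.boundaryEdges i u) f f' → g f = g f' := by
    rintro f f' ⟨d, hd, rfl, rfl⟩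
    rw [← sub_eq_zero, h, boundaryFlow_eq_zero_iff.2 hd]
  have reach : ∀ f, ReflTransGen (T.FaceStep (R.boundaryEdges i u)) T.outerFace f → g f = 0 := by
    intro f hf
    induction hf with
    | refl => exact h₀
    | tail _ h' ih => rw [← step _ _ h', ih]
  have mem : ∀ d : T.graph.Dart, d.edge ∉ R.boundaryEdges i u →
      T.emb.leftFace d.symm ∉ R.regionFaces i u → T.emb.leftFace d ∉ R.regionFaces i u := by
    intro d hd h' h''
    exact h'' ((not_not.1 h').tail ⟨d.symm, by rwa [SimpleGraph.Dart.edge_symm], rfl,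
      by rw [SimpleGraph.Dart.symm_symm]⟩)
  by_cases hf : f ∈ R.regionFaces i u
  · rw [Set.indicator_of_mem hf, Pi.one_apply]
    refine (h01 f).resolve_left fun hf0 => ?_
    -- Lower `g` by 1 on the enclosed faces where it vanishes. No comparison across an edge is
    -- upset: where `g` is 0 on both sides the edge is not on the boundary, so both faces are
    -- enclosed or neither is. The new function is negative at `f`, yet its minimum is its value 0
    -- at the outer face.
    have uni : R.IsUnimodal i fun f => g f - if f ∈ R.regionFaces i u ∧ g f = 0 then 1 else 0 := by
      refine (isUnimodal_of_boundaryFlow h).of_le fun d hd => ?_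
      obtain h1 | h1 := h01 (T.emb.leftFace d)
      · have h2 : g (T.emb.leftFace d.symm) = 0 := by
          obtain h2 | h2 := h01 (T.emb.leftFace d.symm)
          · exact h2
          · rw [h1, h2] at hd; norm_num at hd
        have hd' : d.edge ∉ R.boundaryEdges i u := by
          rw [← boundaryFlow_eq_zero_iff, ← h, h1, h2, sub_zero]
        simp only [h1, h2, and_true]
        have := mem d hd'
        split_ifs <;> first | (exfalso; tauto) | norm_num
      · have : g (T.emb.leftFace d.symm) ≤ 1 := h1 ▸ hd
        simp only [h1, one_ne_zero, and_false, if_false]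
        split_ifs <;> linarith
    have := uni.outerFace_le f
    have ho : T.outerFace ∉ R.regionFaces i u := fun h' => h' .refl
    simp only [hf, hf0, ho, h₀, false_and, and_self, if_true, if_false] at this
    norm_num at this
  · rw [Set.indicator_of_notMem hf]
    exact reach f (not_not.1 hf)

variable (R)

/-- The boundary flow of a region is the coboundary of the indicator function of the region, and
each inner face belongs to exactly one of the three regions of an inner vertex. -/
theorem regionFaces_spec [Finite V] {u : V} (hu : T.IsInner u) :
    (∀ i d, (R.regionFaces i u).indicator (1 : T.emb.Face → ℝ) (T.emb.leftFace d) -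
      (R.regionFaces i u).indicator 1 (T.emb.leftFace d.symm) = R.boundaryFlow i u d) ∧
    ∀ f, f ≠ T.outerFace → ∑ i, (R.regionFaces i u).indicator (1 : T.emb.Face → ℝ) f = 1 := by
  classical
  have : Finite T.graph.Dart := RotationSystem.finite_dart
  have : Fintype T.graph.Dart := Fintype.ofFinite _
  have hex : ∀ i, ∃ g : T.emb.Face → ℝ,
      (∀ d, g (T.emb.leftFace d) - g (T.emb.leftFace d.symm) = R.boundaryFlow i u d) ∧
      g T.outerFace = 0 := by
    intro i
    obtain ⟨g, hg⟩ := T.emb.exists_potential T.connected (T.outerDart 0) T.euler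
      (R.boundaryFlow_symm i u) fun x => R.sum_boundaryFlow x hu
    exact ⟨fun f => g f - g T.outerFace, fun d => by rw [← hg d]; ring, sub_self _⟩
  choose g hg hg0 using hex
  -- The sum of the three potentials plus the indicator of the outer face has zero coboundary, hence
  -- is constant.
  have hsum : ∀ f, f ≠ T.outerFace → ∑ i, g i f = 1 := by
    intro f hf
    have := T.emb.eq_of_coboundary_eq_zero T.connected
      (g := fun f => ∑ i, g i f + if f = T.outerFace then 1 else 0) ?_ f T.outerFace
    · simpa [hf, hg0] using this
    · intro d
      have h1 := sum_boundaryFlow_eq (R := R) (u := u) d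
      rw [sum_flow_outerDart] at h1
      simp only [← hg, Finset.sum_sub_distrib] at h1
      linarith
  have hnonneg : ∀ i f, 0 ≤ g i f := fun i f => by
    rw [← hg0 i]
    exact (isUnimodal_of_boundaryFlow (hg i)).outerFace_le f
  have hint : ∀ i f, ∃ n : ℤ, g i f = n := by
    intro i
    refine T.emb.face_induction T.connected (d₀ := T.outerDart 0) ⟨0, ?_⟩ ?_
    · rw [T.leftFace_outerDart, hg0, Int.cast_zero]
    · rintro d ⟨n, hn⟩
      obtain ⟨m, hm⟩ := R.exists_int_boundaryFlow i u d
      refine ⟨n - m, ?_⟩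
      push_cast
      rw [← hn, ← hm, ← hg i d]
      ring
  have h01 : ∀ i f, g i f = 0 ∨ g i f = 1 := by
    intro i f
    by_cases hf : f = T.outerFace
    · rw [hf]; exact .inl (hg0 i)
    · have hle : g i f ≤ 1 := by
        rw [← hsum f hf]
        exact Finset.single_le_sum (f := fun i => g i f) (fun i _ => hnonneg i f)
          (Finset.mem_univ i)
      have h0 := hnonneg i f
      obtain ⟨n, hn⟩ := hint i f
      rw [hn] at hle h0 ⊢
      norm_cast at hle h0 ⊢
      lia
  have key : ∀ i f, g i f = (R.regionFaces i u).indicator 1 f := fun i =>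
    indicator_regionFaces (hg i) (hg0 i) (h01 i)
  simp only [← key]
  exact ⟨hg, hsum⟩

end Realizer

end PlaneTriangulation

/-! ### Geometry of the regions: nesting, disjoint paths, counted vertices. -/

namespace PlaneTriangulation

variable {V : Type*} {T : PlaneTriangulation V}

theorem leftFace_ne_outerFace {d : T.graph.Dart} (h : T.IsInner d.fst) :
    T.emb.leftFace d ≠ T.outerFace := by
  intro h'
  obtain ⟨i, rfl⟩ := T.leftFace_eq_outerFace.1 h'
  exact T.not_isInner_A _ h

theorem one_le_indicator_iff {α : Type*} {S : Set α} {a : α} :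
    1 ≤ S.indicator (1 : α → ℝ) a ↔ a ∈ S := by
  by_cases h : a ∈ S <;> simp [h]

namespace Realizer

variable {R : T.Realizer} {u v w : V} {i j : Fin 3} {d e : T.graph.Dart}

theorem outerFace_notMem : T.outerFace ∉ R.regionFaces i u := fun h => h .refl

theorem mem_path_self (i : Fin 3) (u : V) : u ∈ R.path i u := ReflTransGen.refl

theorem A_mem_path (hu : T.IsInner u) (i : Fin 3) : T.A i ∈ R.path i u := R.rooted i u hu

theorem eq_of_A_mem_path (h : T.A j ∈ R.path i u) (hu : T.IsInner u) : j = i := by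
  obtain h' | ⟨x, _, hx⟩ := (ReflTransGen.cases_tail_iff _ _ _).1 h
  · exact absurd h'.symm (hu j)
  · exact (R.eq_of_tree_A hx).symm

theorem path_antisymm (h : v ∈ R.path i u) (h' : u ∈ R.path i v) : u = v := by
  obtain h | ⟨x, hx, hx'⟩ := ReflTransGen.cases_head_iff.1 h
  · exact h
  · exact absurd (hx'.trans h') (R.not_reflTransGen hx)

theorem exists_pathDart (h : v ∈ R.path i u) (hvu : v ≠ u) :
    ∃ d ∈ R.pathDarts i u, d.snd = v := by
  obtain h | ⟨x, hx, hx'⟩ := (ReflTransGen.cases_tail_iff _ _ _).1 h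
  · exact absurd h hvu
  · exact ⟨⟨(x, v), R.adj hx'⟩, ⟨hx', hx⟩, rfl⟩

theorem indicator_sub [Finite V] (hu : T.IsInner u) (i : Fin 3) (d : T.graph.Dart) :
    (R.regionFaces i u).indicator (1 : T.emb.Face → ℝ) (T.emb.leftFace d) -
      (R.regionFaces i u).indicator 1 (T.emb.leftFace d.symm) = R.boundaryFlow i u d :=
  (R.regionFaces_spec hu).1 i d

theorem isUnimodal [Finite V] (hu : T.IsInner u) (i : Fin 3) :
    R.IsUnimodal i ((R.regionFaces i u).indicator 1) :=
  isUnimodal_of_boundaryFlow (R.indicator_sub hu i)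

theorem exists_mem_regionFaces [Finite V] (hu : T.IsInner u)
    {f : T.emb.Face} (hf : f ≠ T.outerFace) :
    ∃ i, f ∈ R.regionFaces i u := by
  by_contra! h
  have := (R.regionFaces_spec hu).2 f hf
  simp [h] at this

theorem regionFaces_unique [Finite V] (hu : T.IsInner u) {f : T.emb.Face}
    (hi : f ∈ R.regionFaces i u)
    (hj : f ∈ R.regionFaces j u) : i = j := by
  by_contra h
  have h1 := (R.regionFaces_spec hu).2 f fun h' => outerFace_notMem (h' ▸ hi)
  have h2 := Finset.sum_le_sum_of_subset_of_nonneg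
    (f := fun i => (R.regionFaces i u).indicator (1 : T.emb.Face → ℝ) f)
    (Finset.subset_univ {i, j}) fun k _ _ => Set.indicator_nonneg (fun _ _ => zero_le_one) _
  rw [Finset.sum_pair h, h1, Set.indicator_of_mem hi, Set.indicator_of_mem hj] at h2
  norm_num at h2

theorem mem_of_boundaryFlow [Finite V] (hu : T.IsInner u) (h : R.boundaryFlow i u d = 1) :
    T.emb.leftFace d ∈ R.regionFaces i u ∧ T.emb.leftFace d.symm ∉ R.regionFaces i u := by
  rw [← R.indicator_sub hu] at h
  by_cases h1 : T.emb.leftFace d ∈ R.regionFaces i u <;>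
    by_cases h2 : T.emb.leftFace d.symm ∈ R.regionFaces i u <;> simp [h1, h2] at h ⊢
  norm_num at h

theorem mem_of_pathDarts_add_one [Finite V] (hu : T.IsInner u) (h : d ∈ R.pathDarts (i + 1) u) :
    T.emb.leftFace d ∈ R.regionFaces i u ∧ T.emb.leftFace d.symm ∉ R.regionFaces i u :=
  mem_of_boundaryFlow hu (by rw [boundaryFlow_of_tree_add_one h.1, flow_pathDarts_of_mem h])

theorem mem_of_pathDarts_add_two [Finite V] (hu : T.IsInner u) (h : d ∈ R.pathDarts (i + 2) u) :
    T.emb.leftFace d.symm ∈ R.regionFaces i u ∧ T.emb.leftFace d ∉ R.regionFaces i u := by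
  have := mem_of_boundaryFlow (R := R) (d := d.symm) (i := i) hu (by
    rw [boundaryFlow_symm, boundaryFlow_of_tree_add_two h.1, flow_pathDarts_of_mem h, neg_neg])
  rwa [SimpleGraph.Dart.symm_symm] at this

theorem mem_iff_of_edge_notMem [Finite V] (hu : T.IsInner u) (h : d.edge ∉ R.boundaryEdges i u) :
    T.emb.leftFace d ∈ R.regionFaces i u ↔ T.emb.leftFace d.symm ∈ R.regionFaces i u := by
  rw [← one_le_indicator_iff, ← one_le_indicator_iff,
    sub_eq_zero.1 ((R.indicator_sub hu i d).trans (boundaryFlow_eq_zero_iff.2 h))]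

theorem edge_notMem_boundaryEdges (hu : T.IsInner u) (h₁ : d.fst ∉ R.path (i + 1) u)
    (h₂ : d.fst ∉ R.path (i + 2) u) : d.edge ∉ R.boundaryEdges i u := by
  have key : ∀ j, d.fst ∉ R.path j u → d.edge ∉ R.pathEdges j u := by
    intro j hj h
    obtain h | h := edge_mem_pathEdges.1 h
    · exact hj h.2
    · exact hj (ReflTransGen.tail h.2 h.1)
  rintro ((h | h) | h)
  · exact key _ h₁ h
  · exact key _ h₂ h
  · obtain rfl | h := edge_mem_outer.1 h
    · refine h₂ ?_
      change T.A (i + 1 + 1) ∈ _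
      rw [Fin.three_add_one_add_one]
      exact A_mem_path hu _
    · obtain rfl := (SimpleGraph.Dart.symm_involutive.eq_iff).1 h
      exact h₁ (A_mem_path hu _)

theorem mem_iff_of_fst_eq [Finite V] (hu : T.IsInner u) (h₁ : d.fst ∉ R.path (i + 1) u)
    (h₂ : d.fst ∉ R.path (i + 2) u) (h : e.fst = d.fst) :
    T.emb.leftFace e ∈ R.regionFaces i u ↔ T.emb.leftFace d ∈ R.regionFaces i u := by
  refine T.emb.rot_induction (d := d)
    (P := fun e => T.emb.leftFace e ∈ R.regionFaces i u ↔ T.emb.leftFace d ∈ R.regionFaces i u)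
    Iff.rfl (fun e he ih => ?_) h
  have he' := (T.emb.rot_fst e).trans he
  rw [mem_iff_of_edge_notMem hu (edge_notMem_boundaryEdges hu (he' ▸ h₁) (he' ▸ h₂)),
    T.emb.leftFace_rot_symm, ih]

theorem fst_mem_regionVertices (h : T.emb.leftFace d ∈ R.regionFaces i u) :
    d.fst ∈ R.regionVertices i u := ⟨d, rfl, h⟩

theorem snd_mem_regionVertices (h : T.emb.leftFace d ∈ R.regionFaces i u) :
    d.snd ∈ R.regionVertices i u :=
  ⟨T.emb.faceNext d, T.emb.faceNext_fst d, by rwa [T.emb.leftFace_faceNext]⟩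

theorem exists_mem_regionVertices [Finite V] (hu : T.IsInner u) (v : V) (hv : T.IsInner v) :
    ∃ i, v ∈ R.regionVertices i u := by
  obtain ⟨d, rfl, _⟩ := R.exists_out_dart 0 hv
  obtain ⟨i, hi⟩ := R.exists_mem_regionFaces hu (leftFace_ne_outerFace hv)
  exact ⟨i, d, rfl, hi⟩

theorem A_notMem_regionVertices [Finite V] (hu : T.IsInner u) : T.A i ∉ R.regionVertices i u := by
  rintro ⟨d, hd, hd'⟩
  have := (isUnimodal (R := R) hu i).around_A hd
  rw [Set.indicator_of_notMem outerFace_notMem] at this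
  rw [Set.indicator_of_mem hd'] at this
  exact one_ne_zero this

/-- The indicator of the region is largest, around a vertex, beside the edge leaving in tree `i +
1`. Hence a region contains the paths in the trees `i + 1` and `i + 2` from each of its vertices. -/
theorem leftFace_mem_of_tree_add_one [Finite V] (hu : T.IsInner u)
    (hd : d.fst ∈ R.regionVertices i u)
    (h : R.tree (i + 1) d.fst d.snd) : T.emb.leftFace d ∈ R.regionFaces i u := by
  obtain ⟨e, he, he'⟩ := hd
  obtain ⟨d₀, h₀, h₀'⟩ := R.exists_out_dart i (R.isInner h)
  obtain ⟨d₂, h₂, h₂'⟩ := R.exists_out_dart (i + 2) (R.isInner h)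
  have := ((isUnimodal (R := R) hu i).around (d := e) (h₀.trans he.symm) h₀' he.symm h
    (h₂.trans he.symm) h₂').2.1
  rw [Set.indicator_of_mem he'] at this
  exact one_le_indicator_iff.1 this

theorem leftFace_symm_mem_of_tree_add_two [Finite V] (hu : T.IsInner u)
    (hd : d.fst ∈ R.regionVertices i u)
    (h : R.tree (i + 2) d.fst d.snd) : T.emb.leftFace d.symm ∈ R.regionFaces i u := by
  obtain ⟨d₀, h₀, h₀'⟩ := R.exists_out_dart i (R.isInner h)
  obtain ⟨d₁, h₁, h₁'⟩ := R.exists_out_dart (i + 1) (R.isInner h)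
  have h1 := leftFace_mem_of_tree_add_one hu (h₁ ▸ hd) h₁'
  have := ((isUnimodal (R := R) hu i).around (d := d) h₀ h₀' h₁ h₁' rfl h).2.2
  rw [Set.indicator_of_mem h1] at this
  exact one_le_indicator_iff.1 this.le

theorem mem_regionVertices_of_mem_path_add_one [Finite V] (hw : T.IsInner w)
    (hu : u ∈ R.regionVertices i w) (h : v ∈ R.path (i + 1) u) : v ∈ R.regionVertices i w := by
  induction h with
  | refl => exact hu
  | @tail a b _ hab ih =>
    exact snd_mem_regionVertices (d := ⟨(a, b), R.adj hab⟩)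
      (leftFace_mem_of_tree_add_one hw ih hab)

theorem mem_regionVertices_of_mem_path_add_two [Finite V] (hw : T.IsInner w)
    (hu : u ∈ R.regionVertices i w) (h : v ∈ R.path (i + 2) u) : v ∈ R.regionVertices i w := by
  induction h with
  | refl => exact hu
  | @tail a b _ hab ih =>
    exact fst_mem_regionVertices (d := ⟨(b, a), (R.adj hab).symm⟩)
      (leftFace_symm_mem_of_tree_add_two (d := ⟨(a, b), R.adj hab⟩) hw ih hab)

theorem self_mem_regionVertices [Finite V] (hu : T.IsInner u) (i : Fin 3) :
    u ∈ R.regionVertices i u := by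
  obtain ⟨d, rfl, h⟩ := R.exists_out_dart (i + 1) hu
  exact fst_mem_regionVertices (mem_of_pathDarts_add_one hu ⟨h, mem_path_self _ _⟩).1

theorem boundaryFlow_outerDart (i : Fin 3) (u : V) :
    R.boundaryFlow i u (T.outerDart (i + 1)).symm = 1 := by
  have h1 : ∀ j, flow (R.pathDarts j u) (T.outerDart (i + 1)) = 0 := fun j =>
    flow_of_notMem (fun h => R.not_tree_A h.1) fun h => R.not_tree_A h.1
  rw [boundaryFlow_symm, boundaryFlow, h1, h1, flow_of_mem (Set.mem_singleton _)]
  · norm_num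
  · intro h
    have := congrArg (fun d : T.graph.Dart => d.fst) h
    exact (by lia : i + 1 ≠ i + 1 + 1) (T.A_injective this)

theorem mem_of_edge_mem_boundaryEdges [Finite V] (hw : T.IsInner w)
    (h : u ∈ R.regionVertices i w) (hd : d.edge ∈ R.boundaryEdges i u) :
    T.emb.leftFace d ∈ R.regionFaces i w ∨ T.emb.leftFace d.symm ∈ R.regionFaces i w := by
  obtain (hd | hd) | hd := hd
  · obtain hd | hd := edge_mem_pathEdges.1 hd
    · exact .inl (leftFace_mem_of_tree_add_one hw
        (mem_regionVertices_of_mem_path_add_one hw h hd.2) hd.1)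
    · exact .inr (leftFace_mem_of_tree_add_one hw
        (mem_regionVertices_of_mem_path_add_one hw h hd.2) hd.1)
  · obtain hd | hd := edge_mem_pathEdges.1 hd
    · exact .inr (leftFace_symm_mem_of_tree_add_two hw
        (mem_regionVertices_of_mem_path_add_two hw h hd.2) hd.1)
    · refine .inl ?_
      have := leftFace_symm_mem_of_tree_add_two hw
        (mem_regionVertices_of_mem_path_add_two hw h hd.2) hd.1
      rwa [SimpleGraph.Dart.symm_symm] at this
  · have h1 := (mem_of_boundaryFlow hw (boundaryFlow_outerDart (R := R) i w)).1
    obtain rfl | hd := edge_mem_outer.1 hd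
    · exact .inr h1
    · obtain rfl := (SimpleGraph.Dart.symm_involutive.eq_iff).1 hd
      exact .inl h1

/-- Each boundary edge of the region of `u` has a side in the region of `w`. A walk of faces that
stays outside the latter therefore never crosses one. -/
theorem regionFaces_subset [Finite V] (hw : T.IsInner w) (h : u ∈ R.regionVertices i w) :
    R.regionFaces i u ⊆ R.regionFaces i w := by
  intro f hf
  by_contra hfw
  have hfw' : ReflTransGen (T.FaceStep (R.boundaryEdges i w)) T.outerFace f := not_not.1 hfw
  refine hf ?_
  suffices ReflTransGen (T.FaceStep (R.boundaryEdges i u)) T.outerFace f ∧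
    f ∉ R.regionFaces i w from this.1
  clear hf hfw
  induction hfw' with
  | refl => exact ⟨.refl, outerFace_notMem⟩
  | @tail f f' _ hff ih =>
    obtain ⟨d, hd, rfl, rfl⟩ := hff
    have h2 := (mem_iff_of_edge_notMem hw hd).not.1 ih.2
    refine ⟨ih.1.tail ⟨d, fun hd' => ?_, rfl, rfl⟩, h2⟩
    exact (mem_of_edge_mem_boundaryEdges hw h hd').elim ih.2 h2

/-- The first edge of the path of `u` in tree `i + 1` separates its region from the outside. If the
regions agree, it lies on the boundary for `w` too, in the same tree. -/
theorem mem_path_of_regionFaces_eq [Finite V] (hu : T.IsInner u) (hw : T.IsInner w)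
    (h : R.regionFaces i u = R.regionFaces i w) : u ∈ R.path (i + 1) w := by
  obtain ⟨d, rfl, hd⟩ := R.exists_out_dart (i + 1) hu
  have h1 := mem_of_pathDarts_add_one hu ⟨hd, mem_path_self _ _⟩
  rw [h] at h1
  by_contra hc
  have h2 := R.indicator_sub hw i d
  rw [boundaryFlow_of_tree_add_one hd, flow_pathDarts_of_notMem hd hc,
    Set.indicator_of_mem h1.1, Set.indicator_of_notMem h1.2] at h2
  norm_num at h2

theorem regionFaces_ssubset [Finite V] (hu : T.IsInner u) (hw : T.IsInner w) (huw : u ≠ w)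
    (h : u ∈ R.regionVertices i w) : R.regionFaces i u ⊂ R.regionFaces i w :=
  (regionFaces_subset hw h).ssubset_of_ne fun h' => huw
    (path_antisymm (mem_path_of_regionFaces_eq hw hu h'.symm)
      (mem_path_of_regionFaces_eq hu hw h'))

/-- At a second meeting point `v`, turn counterclockwise from the edge entering on the path in tree
`i + 2` to the edge leaving in tree `i + 1`. The indicator of the region cannot decrease on the way,
but it starts at 1 and ends at 0. -/
theorem eq_of_mem_path_add_one_add_two [Finite V] (hu : T.IsInner u) (h₁ : v ∈ R.path (i + 1) u)
    (h₂ : v ∈ R.path (i + 2) u) : v = u := by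
  by_contra hvu
  have hv : T.IsInner v := by
    by_contra hv
    obtain ⟨j, rfl⟩ := T.exists_eq_A hv
    have := (eq_of_A_mem_path h₁ hu).symm.trans (eq_of_A_mem_path h₂ hu)
    exact Fin.three_add_one_ne_add_two i this
  obtain ⟨d₀, h₀, h₀'⟩ := R.exists_out_dart i hv
  obtain ⟨d₁, rfl, h₁'⟩ := R.exists_out_dart (i + 1) hv
  obtain ⟨x, hx, hx'⟩ := exists_pathDart h₂ hvu
  have e1 := (mem_of_pathDarts_add_one hu ⟨h₁', h₁⟩).2
  have e2 := (mem_of_pathDarts_add_two hu hx).1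
  have := (le_of_inInterval (j := i) (d := x.symm)
    (g := (R.regionFaces i u).indicator 1)
    (show T.IsInner x.snd by rwa [hx']) (.inr hx.1)
    (fun e _ he => (isUnimodal hu i).le e.symm he) (h₀.trans hx'.symm) h₀' hx'.symm h₁').2
  rw [Set.indicator_of_mem e2] at this
  exact e1 (one_le_indicator_iff.1 this)

theorem path_disjoint [Finite V] (hu : T.IsInner u) (hij : i ≠ j) (hi : v ∈ R.path i u)
    (hj : v ∈ R.path j u) : v = u := by
  obtain rfl | rfl | rfl := Fin.three_cases i j
  · exact absurd rfl hij
  · exact eq_of_mem_path_add_one_add_two (i := i + 2) hu (by rwa [Fin.three_add_two_add_one])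
      (by rwa [Fin.three_add_two_add_two])
  · exact eq_of_mem_path_add_one_add_two (i := i + 1) hu (by rwa [Fin.three_add_one_add_one])
      (by rwa [Fin.three_add_one_add_two])

theorem mem_regionVertices_of_mem_path [Finite V] (hu : T.IsInner u) (h : v ∈ R.path j u)
    (hvu : v ≠ u) : v ∈ R.regionVertices (j + 1) u ∧ v ∈ R.regionVertices (j + 2) u ∧
      v ∉ R.regionVertices j u := by
  obtain ⟨d, hd, rfl⟩ := exists_pathDart h hvu
  have h1 := (mem_of_pathDarts_add_one (i := j + 2) hu (by rwa [Fin.three_add_two_add_one])).1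
  have h2 := (mem_of_pathDarts_add_two (i := j + 1) hu (by rwa [Fin.three_add_one_add_two])).1
  refine ⟨fst_mem_regionVertices h2, snd_mem_regionVertices h1, ?_⟩
  rintro ⟨e, he, he'⟩
  rw [mem_iff_of_fst_eq (d := d.symm) hu
    (fun h' => hvu (path_disjoint hu (Fin.three_add_one_ne j) h' h))
    (fun h' => hvu (path_disjoint hu (Fin.three_add_two_ne j) h' h)) he] at he'
  exact Fin.three_add_one_ne j (regionFaces_unique hu h2 he')

variable (R) in
/-- The vertices counted by the `i`-th coordinate of `u` in the vertex-counting drawing. -/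
def countedVertices (i : Fin 3) (u : V) : Set V := R.regionVertices i u \ R.path (i + 2) u

theorem ncard_countedVertices [Finite V] (hu : T.IsInner u) (i : Fin 3) :
    ((R.countedVertices i u).ncard : ℝ) =
      (R.regionVertices i u).ncard - (R.path (i + 2) u).ncard := by
  rw [countedVertices, Set.cast_ncard_sdiff _ (Set.toFinite _)]
  exact fun v hv => mem_regionVertices_of_mem_path_add_two hu (self_mem_regionVertices hu i) hv

/-- A vertex off the three paths is interior to one region. A vertex of path `j` other than `u`
borders the regions `j + 1` and `j + 2`, and the former discards it. -/
theorem existsUnique_countedVertices [Finite V] (hu : T.IsInner u) (hvu : v ≠ u) :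
    ∃! i, v ∈ R.countedVertices i u := by
  by_cases h : ∃ j, v ∈ R.path j u
  · obtain ⟨j, hj⟩ := h
    obtain ⟨_, h2, h0⟩ := mem_regionVertices_of_mem_path hu hj hvu
    refine ⟨j + 2, ⟨h2, fun h' => hvu (path_disjoint hu ?_ h' hj)⟩, fun k hk => ?_⟩
    · lia
    · obtain rfl | rfl | rfl := Fin.three_cases j k
      · exact absurd hk.1 h0
      · exact absurd hj (by have := hk.2; rwa [Fin.three_add_one_add_two] at this)
      · rfl
  · push Not at h
    have hv : T.IsInner v := fun i hi => h i (hi ▸ A_mem_path hu i)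
    obtain ⟨i, d, rfl, hd⟩ := exists_mem_regionVertices (R := R) hu v hv
    refine ⟨i, ⟨fst_mem_regionVertices hd, h _⟩, ?_⟩
    rintro k ⟨⟨e, he, he'⟩, _⟩
    exact regionFaces_unique hu ((mem_iff_of_fst_eq hu (h _) (h _) he).1 he') hd

theorem self_notMem_countedVertices : u ∉ R.countedVertices i u := fun h => h.2 (mem_path_self _ _)

theorem sum_ncard_countedVertices [Finite V] (hu : T.IsInner u) :
    ∑ i, (R.countedVertices i u).ncard + 1 = Nat.card V := by
  have h : ⋃ i, R.countedVertices i u = {u}ᶜ := by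
    ext v
    simp only [Set.mem_iUnion, Set.mem_compl_iff, Set.mem_singleton_iff]
    exact ⟨fun ⟨i, hi⟩ h => self_notMem_countedVertices (h ▸ hi),
      fun h => (existsUnique_countedVertices hu h).exists⟩
  have hdis : Pairwise (Function.onFun Disjoint fun i => R.countedVertices i u) := by
    intro i j hij
    refine Set.disjoint_left.2 fun v hi hj => hij ?_
    exact (existsUnique_countedVertices hu
      fun h => self_notMem_countedVertices (h ▸ hi)).unique hi hj
  have h1 := Set.ncard_iUnion_of_finite (fun i => (R.countedVertices i u).toFinite) hdis
  rw [h, finsum_eq_sum_of_fintype] at h1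
  rw [← h1, ← Set.ncard_add_ncard_compl {u}, Set.ncard_singleton, add_comm]

theorem A_mem_countedVertices [Finite V] (hu : T.IsInner u) :
    T.A (i + 1) ∈ R.countedVertices i u := by
  have hne : T.A (i + 1) ≠ u := (hu _).symm
  have := (mem_regionVertices_of_mem_path hu (A_mem_path (R := R) hu (i + 1)) hne).2.1
  rw [Fin.three_add_one_add_two] at this
  exact ⟨this, fun h => Fin.three_add_one_ne_add_two i (eq_of_A_mem_path h hu)⟩

/-- The danger is a vertex `v` on path `i + 2` of `w` but not of `u`. The face left of its edge
leaving in tree `i + 2` is outside the region of `w`. Yet it is inside: either all faces at `v` lie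
in the region of `u`, or `v` is on path `i + 1` of `u` and monotonicity in interval `i + 2` carries
membership over from the edge by which that path enters `v`. -/
theorem countedVertices_subset [Finite V] (hu : T.IsInner u) (hw : T.IsInner w)
    (h : u ∈ R.regionVertices i w) : R.countedVertices i u ⊆ R.countedVertices i w := by
  rintro v ⟨⟨e, he, he'⟩, hv2⟩
  refine ⟨⟨e, he, regionFaces_subset hw h he'⟩, fun hvw => ?_⟩
  have hv : T.IsInner v := by
    by_contra hv
    obtain ⟨j, rfl⟩ := T.exists_eq_A hv
    obtain rfl := eq_of_A_mem_path hvw hw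
    exact hv2 (A_mem_path hu _)
  obtain ⟨d₂, h₂, h₂'⟩ := R.exists_out_dart (i + 2) hv
  obtain ⟨d₀, h₀, h₀'⟩ := R.exists_out_dart i hv
  have hd₂ := (mem_of_pathDarts_add_two hw ⟨h₂', h₂.symm ▸ hvw⟩).2
  have hv1 : v ∈ R.path (i + 1) u := by
    by_contra hv1
    subst he
    exact hd₂ (regionFaces_subset hw h ((mem_iff_of_fst_eq hu hv1 hv2 h₂).2 he'))
  obtain ⟨x, hx, hx'⟩ := exists_pathDart hv1 fun h' => hv2 (h' ▸ mem_path_self _ _)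
  have hxw := leftFace_mem_of_tree_add_one hw
    (mem_regionVertices_of_mem_path_add_one hw h hx.2) hx.1
  have hd : T.emb.rot (T.emb.rot.symm x.symm) = x.symm := Equiv.apply_symm_apply _ _
  have hd1 : (T.emb.rot.symm x.symm).fst = v := (T.emb.rot_symm_fst _).trans hx'
  have hd2 : T.emb.leftFace (T.emb.rot.symm x.symm) = T.emb.leftFace x := by
    rw [← T.emb.leftFace_rot_symm, hd, SimpleGraph.Dart.symm_symm]
  have := (ge_of_inInterval (j := i + 2) (d := T.emb.rot.symm x.symm)
    (g := (R.regionFaces i w).indicator 1) (hd1.symm ▸ hv)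
    (inInterval_of_rot (hd1.symm ▸ hv)
      (by rw [hd, Fin.three_add_two_add_two]; exact hx.1))
    (fun e _ he => (isUnimodal hw i).ge e.symm (by rwa [Fin.three_add_two_add_two] at he))
    (h₂.trans hd1.symm) h₂' (h₀.trans hd1.symm) (by rwa [Fin.three_add_two_add_one])).2
  rw [hd2, Set.indicator_of_mem hxw] at this
  exact hd₂ (one_le_indicator_iff.1 this)

/-- The vertex `u` itself witnesses strictness, except when it is on path `i + 2` of `w`. It is then
counted for `w` in region `i + 1`, since it is not on path `i`. -/
theorem ncard_countedVertices_lt [Finite V] (hu : T.IsInner u) (hw : T.IsInner w) (huw : u ≠ w)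
    (h : u ∈ R.regionVertices i w) :
    (R.countedVertices i u).ncard < (R.countedVertices i w).ncard ∨
    (R.countedVertices i u).ncard = (R.countedVertices i w).ncard ∧
      (R.countedVertices (i + 1) u).ncard < (R.countedVertices (i + 1) w).ncard := by
  have lt : ∀ j, u ∈ R.regionVertices j w → u ∉ R.path (j + 2) w →
      (R.countedVertices j u).ncard < (R.countedVertices j w).ncard := fun j hj hj' =>
    Set.ncard_lt_ncard (Set.ssubset_iff_of_subset (countedVertices_subset hu hw hj) |>.2
      ⟨u, ⟨hj, hj'⟩, self_notMem_countedVertices⟩)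
  by_cases hp : u ∈ R.path (i + 2) w
  · obtain h1 | h1 := (Set.ncard_le_ncard (countedVertices_subset hu hw h)).lt_or_eq
    · exact .inl h1
    · refine .inr ⟨h1, lt _ ?_ ?_⟩
      · have := (mem_regionVertices_of_mem_path hw hp huw).2.1
        rwa [Fin.three_add_two_add_two] at this
      · rw [Fin.three_add_one_add_two]
        exact fun h' => huw (path_disjoint hw (Fin.three_add_two_ne i) hp h')
  · exact .inl (lt i h hp)

end Realizer

end PlaneTriangulation

/-! ### Distances to the sides as barycentric coordinates, and the criterion for saturation. -/

theorem infDist_line_eq_norm_mk {E : Type*} [NormedAddCommGroup E] [NormedSpace ℝ E] (a c x : E) :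
    Metric.infDist x (line[ℝ, a, c] : Set E) =
      ‖(Submodule.Quotient.mk (x - a) : E ⧸ Submodule.span ℝ {c - a})‖ := by
  have h1 := QuotientAddGroup.norm_mk (S := (Submodule.span ℝ {c - a}).toAddSubgroup) (x - a)
  refine Eq.trans ?_ h1.symm
  rw [← Metric.infDist_image (IsometryEquiv.subRight a).isometry]
  congr 1
  ext y
  constructor
  · rintro ⟨z, hz, rfl⟩
    obtain ⟨r, rfl⟩ := mem_affineSpan_pair_iff_exists_lineMap_eq.1 hz
    exact Submodule.mem_span_singleton.2 ⟨r, by simp [AffineMap.lineMap_apply]⟩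
  · intro hy
    obtain ⟨r, rfl⟩ := Submodule.mem_span_singleton.1 hy
    exact ⟨AffineMap.lineMap a c r, AffineMap.lineMap_mem_affineSpan_pair _ _ _,
      by simp [AffineMap.lineMap_apply]⟩

/-- Modulo the direction of the line the distance becomes a quotient norm, which is homogeneous. -/
theorem infDist_line_add_smul {E : Type*} [NormedAddCommGroup E] [NormedSpace ℝ E] (a b c : E)
    {r : ℝ} (hr : 0 ≤ r) (s : ℝ) :
    Metric.infDist (a + r • (b - a) + s • (c - a)) (line[ℝ, a, c] : Set E) =
      r * Metric.infDist b (line[ℝ, a, c] : Set E) := by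
  rw [infDist_line_eq_norm_mk, infDist_line_eq_norm_mk]
  have : (Submodule.Quotient.mk (a + r • (b - a) + s • (c - a) - a) :
      E ⧸ Submodule.span ℝ {c - a}) = r • Submodule.Quotient.mk (b - a) := by
    rw [← Submodule.Quotient.mk_smul, Submodule.Quotient.eq]
    refine Submodule.mem_span_singleton.2 ⟨s, ?_⟩
    abel
  rw [this, norm_smul, Real.norm_of_nonneg hr]

theorem Fin.sum_univ_three_eq {M : Type*} [AddCommMonoid M] (f : Fin 3 → M) (i : Fin 3) :
    ∑ j, f j = f i + f (i + 1) + f (i + 2) := by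
  fin_cases i
  · exact Fin.sum_univ_three f
  · change _ = f 1 + f 2 + f 0
    rw [Fin.sum_univ_three]; abel
  · change _ = f 2 + f 0 + f 1
    rw [Fin.sum_univ_three]; abel

namespace PlaneTriangulation

variable {V : Type*} {T : PlaneTriangulation V} {p : V → EuclideanSpace ℝ (Fin 3)}

/-- The functional `φ` is constant on the side opposite to `A i` and takes another value at `A i`.
-/
theorem coord_A_pos {i : Fin 3} (φ : EuclideanSpace ℝ (Fin 3) →ₗ[ℝ] ℝ)
    (h₁ : φ (p (T.A (i + 1))) = φ (p (T.A (i + 2))))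
    (h₂ : φ (p (T.A i)) ≠ φ (p (T.A (i + 1)))) : 0 < T.coord p i (T.A i) := by
  refine ((AffineSubspace.closed_of_finiteDimensional _).notMem_iff_infDist_pos
    ⟨_, left_mem_affineSpan_pair ℝ _ _⟩).1 fun h => h₂ ?_
  obtain ⟨r, hr⟩ := mem_affineSpan_pair_iff_exists_lineMap_eq.1 h
  rw [← hr, AffineMap.lineMap_apply]
  simp [h₁]

/-- `l u` are the barycentric coordinates of the position of `u` in the outer triangle. -/
structure IsBarycentric (T : PlaneTriangulation V) (p : V → EuclideanSpace ℝ (Fin 3))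
    (l : V → Fin 3 → ℝ) : Prop where
  nonneg : ∀ v i, 0 ≤ l v i
  sum_eq : ∀ v, ∑ i, l v i = 1
  eq_sum : ∀ v, p v = ∑ i, l v i • p (T.A i)
  coord_pos : ∀ i, 0 < T.coord p i (T.A i)

namespace IsBarycentric

variable {l : V → Fin 3 → ℝ}

theorem coord_eq (h : T.IsBarycentric p l) (i : Fin 3) (v : V) :
    T.coord p i v = l v i * T.coord p i (T.A i) := by
  rw [coord, coord, ← infDist_line_add_smul _ _ _ (h.nonneg v i) (l v (i + 2)), h.eq_sum v,
    Fin.sum_univ_three_eq _ i]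
  congr 1
  have := h.sum_eq v
  rw [Fin.sum_univ_three_eq _ i] at this
  have h' : l v (i + 1) = 1 - l v i - l v (i + 2) := by linarith
  rw [h']
  module

theorem lt_iff (h : T.IsBarycentric p l) {i : Fin 3} {u v : V} : T.lt p i u v ↔ l u i < l v i := by
  rw [lt, h.coord_eq i u, h.coord_eq i v, mul_lt_mul_iff_left₀ (h.coord_pos i)]

theorem mem_sector_iff (h : T.IsBarycentric p l) {k : Fin 3} {u v : V} :
    v ∈ T.sector p k u ↔ l u k < l v k ∧ ∀ j, j ≠ k → l v j < l u j := by
  simp only [sector, h.lt_iff, Set.mem_inter_iff, Set.mem_ofPred_eq, and_iff_left_iff_imp]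
  intro _
  rw [h.eq_sum v]
  exact (convex_convexHull ℝ _).sum_mem (fun i _ => h.nonneg v i) (h.sum_eq v)
    fun i _ => subset_convexHull ℝ _ ⟨i, rfl⟩

end IsBarycentric

/-- A drawing whose barycentric coordinates respect the order of the regions is saturated. -/
theorem isSaturated_of_isBarycentric [Finite V] {l : V → Fin 3 → ℝ} (R : T.Realizer)
    (h : T.IsBarycentric p l) (hA : ∀ i, l (T.A i) i = 1) (hA' : ∀ i j, j ≠ i → l (T.A i) j = 0)
    (pos : ∀ u, T.IsInner u → ∀ i, 0 < l u i)
    (mono : ∀ u w, T.IsInner u → T.IsInner w → u ≠ w → ∀ i, u ∈ R.regionVertices i w →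
      l u i < l w i) : T.IsSaturated p := by
  have lt_one : ∀ u, T.IsInner u → ∀ i, l u i < 1 := by
    intro u hu i
    have := h.sum_eq u
    rw [Fin.sum_univ_three_eq _ i] at this
    linarith [pos u hu (i + 1), pos u hu (i + 2)]
  have tree : ∀ k u v, R.tree k u v → l u k < l v k ∧ ∀ j, j ≠ k → l v j < l u j := by
    intro k u v huv
    have hu := R.isInner huv
    have hne : v ≠ u := (R.adj huv).ne'
    by_cases hv : T.IsInner v
    · obtain ⟨h1, h2, -⟩ := Realizer.mem_regionVertices_of_mem_path (R := R) (j := k) hu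
        (ReflTransGen.single huv) hne
      have m1 := mono v u hv hu hne _ h1
      have m2 := mono v u hv hu hne _ h2
      constructor
      -- `u` lies in some region of `v`, and `m1`, `m2` exclude all but the `k`-th.
      · obtain ⟨i, hi⟩ := Realizer.exists_mem_regionVertices (R := R) hv u hu
        have m0 := mono u v hu hv hne.symm i hi
        obtain rfl | rfl | rfl := Fin.three_cases k i
        · exact m0
        · exact absurd m0 m1.not_gt
        · exact absurd m0 m2.not_gt
      · intro j hj
        obtain rfl | rfl | rfl := Fin.three_cases k j
        · exact absurd rfl hj
        · exact m1
        · exact m2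
    · obtain ⟨i, rfl⟩ := T.exists_eq_A hv
      obtain rfl := R.eq_of_tree_A huv
      exact ⟨by rw [hA]; exact lt_one u hu _, fun j hj => by rw [hA' _ _ hj]; exact pos u hu j⟩
  have nbr : ∀ k u v, T.IsInner u → T.graph.Adj u v →
      (l u k < l v k ∧ ∀ j, j ≠ k → l v j < l u j) → R.tree k u v := by
    intro k u v hu huv ⟨h1, h2⟩
    obtain ⟨i, hi | hi⟩ := R.exists_inInterval (d := ⟨(u, v), huv⟩) hu
    · by_cases hik : i = k
      · rwa [← hik]
      · exact absurd (h2 i hik) (tree i u v hi).1.not_gt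
    -- For an edge entering `u` in tree `i + 2`, two of the coordinates are larger at `v`, and at
    -- least one of them has index different from `k`.
    · obtain ⟨j, hj, hj'⟩ : ∃ j, j ≠ k ∧ j ≠ i + 2 := by
        clear * -
        revert i k; decide
      exact absurd (h2 j hj) ((tree _ v u hi).2 j hj').not_gt
  intro u hu k
  simp only [IsSectorMin, h.mem_sector_iff, h.lt_iff]
  obtain ⟨v, huv, -⟩ := R.existsUnique_out k u hu
  refine ⟨⟨v, ⟨tree k u v huv, R.adj huv⟩, fun v' hv' =>
    R.out_unique (nbr k u v' hu hv'.2 hv'.1) huv⟩, fun v' hv' hadj => ?_⟩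
  obtain rfl := R.out_unique (nbr k u v' hu hadj hv') huv
  have min : ∀ w, (l u k < l w k ∧ ∀ j, j ≠ k → l w j < l u j) → w ≠ v' → l v' k < l w k := by
    rintro w ⟨hw1, hw2⟩ hwv
    by_cases hw : T.IsInner w
    · have huw : u ≠ w := by rintro rfl; exact lt_irrefl _ hw1
      -- No, only region `k` of `w` can contain `u`, hence the face left of `u → v'` and with it
      -- `v'`.
      have hnot : ∀ j, j ≠ k → u ∉ R.regionVertices j w := fun j hj hj' =>
        (hw2 j hj).not_gt (mono u w hu hw huw j hj')
      obtain ⟨i, hi⟩ := R.exists_mem_regionFaces hw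
        (leftFace_ne_outerFace (d := ⟨(u, v'), hadj⟩) hu)
      obtain rfl : i = k := by
        by_contra hik
        exact hnot i hik (Realizer.fst_mem_regionVertices hi)
      have hv : v' ∈ R.regionVertices i w := Realizer.snd_mem_regionVertices hi
      refine mono v' w ?_ hw hwv.symm i hv
      by_contra hv'
      obtain ⟨j, rfl⟩ := T.exists_eq_A hv'
      obtain rfl := R.eq_of_tree_A huv
      exact Realizer.A_notMem_regionVertices hw hv
    · obtain ⟨i, rfl⟩ := T.exists_eq_A hw
      obtain rfl : k = i := by
        by_contra hik
        rw [hA' _ _ hik] at hw1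
        exact hw1.not_gt (pos u hu k)
      rw [hA]
      refine lt_one v' ?_ k
      by_contra hv'
      obtain ⟨j, rfl⟩ := T.exists_eq_A hv'
      exact hwv (by rw [R.eq_of_tree_A huv])
  refine ⟨hv', min, fun w hw hlt => ?_⟩
  by_cases hwv : w = v'
  · subst hwv; exact lt_irrefl _ hlt.1
  · exact hlt.1.not_gt (min w hw hwv)

/-! ### The two kinds of drawings. -/

namespace Realizer

variable [Finite V] {R : T.Realizer}

theorem IsFaceDrawing.isSaturated {w : T.emb.Face → ℝ} (hw : ∀ f, f ≠ T.outerFace → 0 < w f)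
    (hw1 : ∑ᶠ f ∈ {f | f ≠ T.outerFace}, w f = 1) (hp : R.IsFaceDrawing w p) :
    T.IsSaturated p := by
  classical
  have : Finite T.emb.Face := T.emb.finite_face
  have : Fintype T.emb.Face := Fintype.ofFinite _
  have hsum : ∀ S : Set T.emb.Face, ∑ᶠ f ∈ S, w f = ∑ f, S.indicator w f := fun S => by
    rw [finsum_mem_def, finsum_eq_sum_of_fintype]
  obtain ⟨hpA, hpu⟩ := hp
  simp only [hsum] at hw1 hpu
  have hne : ∀ {u i f}, f ∈ R.regionFaces i u → f ≠ T.outerFace := fun hf h =>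
    outerFace_notMem (h ▸ hf)
  have hind : ∀ u i f, 0 ≤ (R.regionFaces i u).indicator w f := fun u i f =>
    Set.indicator_nonneg (fun f hf => (hw f (hne hf)).le) f
  have hpA1 : ∀ i, p (T.A i) i = 1 := fun i => by simp [hpA]
  have hpA0 : ∀ i j, j ≠ i → p (T.A i) j = 0 := fun i j hj => by simp [hpA, hj]
  have pos : ∀ u, T.IsInner u → ∀ i, 0 < p u i := by
    intro u hu i
    rw [hpu u hu]
    obtain ⟨d, -, hd⟩ := self_mem_regionVertices (R := R) hu i
    refine Finset.sum_pos' (fun f _ => hind u i f) ⟨_, Finset.mem_univ (T.emb.leftFace d), ?_⟩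
    rw [Set.indicator_of_mem hd]
    exact hw _ (hne hd)
  refine isSaturated_of_isBarycentric (l := fun v i => p v i) R ⟨?_, ?_, ?_, ?_⟩ hpA1 hpA0 pos ?_
  · intro v i
    by_cases hv : T.IsInner v
    · exact (pos v hv i).le
    · obtain ⟨j, rfl⟩ := T.exists_eq_A hv
      by_cases hij : i = j
      · rw [hij, hpA1]; exact zero_le_one
      · rw [hpA0 _ _ hij]
  · intro v
    by_cases hv : T.IsInner v
    · simp only [hpu v hv]
      rw [Finset.sum_comm, ← hw1]
      refine Finset.sum_congr rfl fun f _ => ?_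
      have key : ∀ S : Set T.emb.Face, S.indicator w f = S.indicator (1 : T.emb.Face → ℝ) f * w f :=
        fun S => by by_cases h : f ∈ S <;> simp [h]
      simp only [key, ← Finset.sum_mul]
      by_cases hf : f = T.outerFace
      · simp [hf, outerFace_notMem]
      · rw [(R.regionFaces_spec hv).2 f hf, Set.indicator_of_mem (show f ∈ {f | f ≠ _} from hf)]
        rfl
    · obtain ⟨j, rfl⟩ := T.exists_eq_A hv
      exact (Finset.sum_eq_single (f := fun i => p (T.A j) i) j
        (fun i _ h => hpA0 _ _ h) (by simp)).trans (hpA1 j)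
  · intro v
    ext i
    simp [hpA, Pi.single_apply]
  · intro i
    refine coord_A_pos (EuclideanSpace.proj i).toLinearMap ?_ ?_
    · simp [hpA]
    · simp [hpA]
  · intro u v hu hv huv i h
    change p u i < p v i
    rw [hpu u hu, hpu v hv]
    obtain ⟨hsub, f, hf, hf'⟩ := Set.ssubset_iff_exists.1 (regionFaces_ssubset hu hv huv h)
    refine Finset.sum_lt_sum (fun f _ => ?_) ⟨f, Finset.mem_univ f, ?_⟩
    · by_cases hf : f ∈ R.regionFaces i u
      · rw [Set.indicator_of_mem hf, Set.indicator_of_mem (hsub hf)]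
      · rw [Set.indicator_of_notMem hf]
        exact hind v i f
    · rw [Set.indicator_of_mem hf, Set.indicator_of_notMem hf']
      exact hw f (hne hf)

theorem IsVertexDrawing.isSaturated (hp : R.IsVertexDrawing p) : T.IsSaturated p := by
  -- An inner vertex is fixed first, to have at least four vertices and hence `m ≥ 2`.
  intro u₀ hu₀
  suffices T.IsSaturated p from this u₀ hu₀
  obtain ⟨hpA, hpu⟩ := hp
  obtain ⟨m, hm⟩ : ∃ m : ℝ, m = Nat.card V - 2 := ⟨_, rfl⟩
  have hn1 : (Nat.card V : ℝ) - 1 = m + 1 := by rw [hm]; ring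
  have hN : ∀ u, T.IsInner u → ∀ i, 1 ≤ (R.countedVertices i u).ncard := fun u hu i =>
    (Set.ncard_pos (Set.toFinite _)).2 ⟨_, A_mem_countedVertices hu⟩
  have hNsum : ∀ u, T.IsInner u → ∀ i, (R.countedVertices i u).ncard +
      (R.countedVertices (i + 1) u).ncard + (R.countedVertices (i + 2) u).ncard + 1 = Nat.card V :=
    fun u hu i => by rw [← Fin.sum_univ_three_eq (fun i => (R.countedVertices i u).ncard),
      sum_ncard_countedVertices hu]
  have hm2 : 2 ≤ m := by
    have h4 : 4 ≤ Nat.card V := by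
      have := hNsum u₀ hu₀ 0
      have := hN u₀ hu₀ 0
      have := hN u₀ hu₀ (0 + 1)
      have := hN u₀ hu₀ (0 + 2)
      lia
    have : (4 : ℝ) ≤ Nat.card V := by exact_mod_cast h4
    linarith
  have hm1 : m + 1 ≠ 0 := by linarith
  have hD : 0 < m ^ 2 - m + 1 := by nlinarith
  have hpu' : ∀ u, T.IsInner u → ∀ i, p u i * (m + 1) = (R.countedVertices i u).ncard := by
    intro u hu i
    rw [hpu u hu, hn1, ncard_countedVertices hu, div_mul_cancel₀ _ hm1]
  simp only [hn1, ← hm] at hpA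
  have hA0 : ∀ i, p (T.A i) i * (m + 1) = m := fun i => by
    rw [(hpA i).1, div_mul_cancel₀ _ hm1]
  have hA1 : ∀ i, p (T.A i) (i + 1) * (m + 1) = 1 := fun i => by
    rw [(hpA i).2.1, div_mul_cancel₀ _ hm1]
  have hA2 : ∀ i, p (T.A i) (i + 2) * (m + 1) = 0 := fun i => by
    rw [(hpA i).2.2, zero_mul]
  have hsum : ∀ v i, p v i * (m + 1) + p v (i + 1) * (m + 1) + p v (i + 2) * (m + 1) = m + 1 := by
    intro v
    by_cases hv : T.IsInner v
    · intro i
      have := hNsum v hv i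
      rw [hpu' v hv, hpu' v hv, hpu' v hv, ← hn1, ← this]
      push_cast
      ring
    · obtain ⟨j, rfl⟩ := T.exists_eq_A hv
      intro i
      rw [← Fin.sum_univ_three_eq (fun i => p (T.A j) i * (m + 1)), Fin.sum_univ_three_eq _ j,
        hA0, hA1, hA2, add_zero]
  -- With coordinates scaled by `n - 1 = m + 1`, `A i` is the cyclic shift of `(m, 1, 0)`, so `x i =
  -- m * l i + l (i + 2)`. Then `m * x i + x (i + 1) = (m ^ 2 + 1) * l i + m * (1 - l i)`, which is
  -- solved for `l i`.
  let l : V → Fin 3 → ℝ := fun v i =>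
    (m * (p v i * (m + 1)) + p v (i + 1) * (m + 1) - m) / (m ^ 2 - m + 1)
  have hl : ∀ v i, l v i =
    (m * (p v i * (m + 1)) + p v (i + 1) * (m + 1) - m) / (m ^ 2 - m + 1) := fun _ _ => rfl
  have hlA : ∀ i, l (T.A i) i = 1 := by
    intro i
    rw [hl, hA0, hA1, div_eq_one_iff_eq hD.ne']
    ring
  have hlA' : ∀ i j, j ≠ i → l (T.A i) j = 0 := by
    intro i j hj
    rw [hl]
    obtain rfl | rfl | rfl := Fin.three_cases i j
    · exact absurd rfl hj
    · rw [Fin.three_add_one_add_one, hA1, hA2]; simp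
    · rw [Fin.three_add_two_add_one, hA0, hA2]; simp
  have pos : ∀ u, T.IsInner u → ∀ i, 0 < l u i := by
    intro u hu i
    refine div_pos ?_ hD
    rw [hpu' u hu, hpu' u hu]
    have h1 : (1 : ℝ) ≤ (R.countedVertices i u).ncard := by exact_mod_cast hN u hu i
    have h2 : (1 : ℝ) ≤ (R.countedVertices (i + 1) u).ncard := by exact_mod_cast hN u hu _
    nlinarith
  refine isSaturated_of_isBarycentric (l := l) R ⟨?_, ?_, ?_, ?_⟩ hlA hlA' pos ?_
  · intro v i
    by_cases hv : T.IsInner v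
    · exact (pos v hv i).le
    · obtain ⟨j, rfl⟩ := T.exists_eq_A hv
      by_cases hij : i = j
      · rw [hij, hlA]; exact zero_le_one
      · rw [hlA' _ _ hij]
  · intro v
    rw [Fin.sum_univ_three_eq _ 0, hl, hl, hl, Fin.three_add_one_add_one, Fin.three_add_two_add_one,
      ← add_div, ← add_div, div_eq_one_iff_eq hD.ne']
    linear_combination (m + 1) * hsum v 0
  · intro v
    ext i
    rw [Fin.sum_univ_three_eq _ i]
    have e0 := hA0 i
    have e1 := hA2 (i + 1)
    have e2 := hA1 (i + 2)
    rw [Fin.three_add_one_add_two] at e1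
    rw [Fin.three_add_two_add_one] at e2
    simp only [PiLp.add_apply, PiLp.smul_apply, smul_eq_mul]
    refine mul_right_cancel₀ hm1 ?_
    rw [add_mul, add_mul, mul_assoc, mul_assoc, mul_assoc, e0, e1, e2, hl, hl, hl,
      Fin.three_add_two_add_one, div_mul_eq_mul_div, div_mul_eq_mul_div, div_mul_eq_mul_div,
      ← add_div, ← add_div, eq_div_iff hD.ne']
    linear_combination (-m) * hsum v i
  · intro i
    refine coord_A_pos (m • (EuclideanSpace.proj i).toLinearMap +
      (EuclideanSpace.proj (i + 1)).toLinearMap) ?_ ?_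
    · refine mul_right_cancel₀ hm1 ?_
      have e1 := hA0 (i + 1)
      have e2 := hA2 (i + 1)
      have e3 := hA1 (i + 2)
      have e4 := hA2 (i + 2)
      rw [Fin.three_add_one_add_two] at e2
      rw [Fin.three_add_two_add_one] at e3
      rw [Fin.three_add_two_add_two] at e4
      change (m * p (T.A (i + 1)) i + p (T.A (i + 1)) (i + 1)) * (m + 1) =
        (m * p (T.A (i + 2)) i + p (T.A (i + 2)) (i + 1)) * (m + 1)
      linear_combination m * e2 + e1 - m * e3 - e4
    · intro h
      have e1 := hA0 (i + 1)
      have e2 := hA2 (i + 1)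
      have e3 := hA0 i
      have e4 := hA1 i
      rw [Fin.three_add_one_add_two] at e2
      change m * p (T.A i) i + p (T.A i) (i + 1) =
        m * p (T.A (i + 1)) i + p (T.A (i + 1)) (i + 1) at h
      refine hD.ne' ?_
      linear_combination (m + 1) * h - m * e3 - e4 + m * e2 + e1
  · intro u v hu hv huv i h
    refine (div_lt_div_iff_of_pos_right hD).2 ?_
    rw [hpu' u hu, hpu' u hu, hpu' v hv, hpu' v hv]
    obtain h1 | ⟨h1, h2⟩ := ncard_countedVertices_lt hu hv huv h
    · have h1' : ((R.countedVertices i u).ncard : ℝ) + 1 ≤ (R.countedVertices i v).ncard := by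
        exact_mod_cast h1
      -- The `(i + 1)`-st count drops by at most `n - 4 = m - 2`, less than the gain of at least `m`
      -- from the `i`-th count.
      have h3 : (R.countedVertices (i + 1) u).ncard + 3 ≤
          Nat.card V + (R.countedVertices (i + 1) v).ncard - 1 := by
        have := hNsum u hu i
        have := hN u hu i
        have := hN u hu (i + 2)
        have := hN v hv (i + 1)
        lia
      have h3' : ((R.countedVertices (i + 1) u).ncard : ℝ) + 4 ≤
          Nat.card V + (R.countedVertices (i + 1) v).ncard := by
        have : (R.countedVertices (i + 1) u).ncard + 4 ≤
          Nat.card V + (R.countedVertices (i + 1) v).ncard := by lia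
        exact_mod_cast this
      nlinarith
    · have h2' : ((R.countedVertices (i + 1) u).ncard : ℝ) <
          (R.countedVertices (i + 1) v).ncard := by exact_mod_cast h2
      rw [h1]
      linarith

end Realizer

end PlaneTriangulation

theorem mainTheorem1 {V : Type*} [Finite V] (T : PlaneTriangulation V)
    (p : V → EuclideanSpace ℝ (Fin 3)) (hp : T.IsSchnyderDrawing p) : T.IsSaturated p := by
  obtain ⟨R, ⟨w, hw, hw1, h⟩ | h⟩ := hp
  · exact h.isSaturated hw hw1
  · exact h.isSaturated
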